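/- **Setting.** Let $C>0$ (capacity of a shuttle), $T>0$ (length of the arrival period), $\nu\ge 0$ (loading rate) and $\pi>0$ (return time) be real numbers, and let $D\colon[0,T]\to\mathbb{R}_+$ (cumulative demand) be nondecreasing and upper semicontinuous with $D(T)>0$. For $y\in[0,D(T)]$ put $$\bar\tau(y)=\inf\{t\in[0,T]: D(t)\ge y\},\qquad \tau(y)=\begin{cases}\inf\{t\in[0,T]: D(t)>y\}& \text{if } y<D(T),\\ T&\text{if } y=D(T).\end{cases}$$ For an integer $S\ge 1$ (number of shuttles), a *feasible schedule* is a pair of sequences of nonnegative reals $d_1,d_2,\dots$ (departure times) and $y_1,y_2,\dots$ (cumulative loads) such that, with $y_0=0$, for all $j\ge1$: $0\le y_j-y_{j-1}\le C$; $d_j\le d_{j+1}$; $\bar\tau(y_j)+\nu(y_j-y_{j-1})\le d_j$; $d_j+\pi+\nu(y_{j+S}-y_{j+S-1})\le d_{j+S}$; and $\lim_{j\to\infty}y_j=D(T)$. Its maximum waiting time is $$g^{\max}(d,y)=\sup_{j\ge1:\ y_j>y_{j-1}}\bigl(d_j-\tau(y_{j-1})\bigr)\in[0,+\infty],$$ and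 $OPT$ is the infimum of $g^{\max}$ over all feasible schedules. **Computational model.** Programs run on a real random access machine with unit-cost addition, truncated subtraction and comparison of natural numbers, unit-cost $+,-,\times,/$ and comparison of real numbers, and arrays of both. The constants $C,T,\nu,\pi$ are available to the program, and each of the following takes one step: evaluating $D(t)$; integrating $D$ between two values; evaluating $\tau(y)$ and $\bar\tau(y)$; evaluating $\sup\{y\in[0,D(T)]:\bar\tau(y)+\nu y\le a\}$. **Theorem.** There is a program with the following property. Suppose that $D$ has a right derivative $D'_+(t)$ at every $t\in[0,T)$ and that $\inf_{t\in[0,T)}D'_+(t)>0$. Then there are constants $K,\beta>0$, depending only on $C,T,D,\nu,\pi$, such that for all integers $S\ge1$ and $M\ge1$ the program, given $S$ and $M$, halts after at most $$K\,\beta^{3S}M^{3S+2}$$ steps and outputs a feasible schedule $(d,y)$ for $S$ shuttles with $$g^{\max}(d,y)\le OPT+K\,\frac{S^2}{M}.$$ The output is a finite list $d_1,\dots,d_N$, $y_1,\dots,y_N$ with $N\ge1$ and $y_N=D(T)$; it stands for the infinite schedule with empty departures $d_j=d_N+(j-N)\pi$, $y_j=D(T)$ for $j>N$. -/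

import Mathlib

open Filter Topology

noncomputable section

namespace Shuttle

/-! ## The scheduling problem -/

/-- The constants of the model: the capacity `C` of a shuttle, the length `T` of the period during
which users arrive, the loading rate `ν`, the return time `π`, and the cumulative demand `D`
(only its values on `[0, T]` are meaningful). -/
structure Terminal where
  C : ℝ
  T : ℝ
  ν : ℝ
  π : ℝ
  D : ℝ → ℝ

namespace Terminal

/-- The standing assumptions on the constants. -/
structure Standing (P : Terminal) : Prop where
  C_pos : 0 < P.C
  T_pos : 0 < P.T
  ν_nonneg : 0 ≤ P.ν
  π_nonneg : 0 ≤ P.π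
  D_nonneg : ∀ t ∈ Set.Icc 0 P.T, 0 ≤ P.D t
  D_mono : MonotoneOn P.D (Set.Icc 0 P.T)
  D_usc : UpperSemicontinuousOn P.D (Set.Icc 0 P.T)
  D_total_pos : 0 < P.D P.T

/-- The pseudo-inverse `τ`: arrival time of the first user after the `y` first ones. -/
def tau (P : Terminal) (y : ℝ) : ℝ :=
  if y < P.D P.T then sInf {t : ℝ | t ∈ Set.Icc 0 P.T ∧ y < P.D t} else P.T

/-- The pseudo-inverse `τ̄`: arrival time of the last of the `y` first users, extended by the
value `T` beyond the total demand. -/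
def tauBar (P : Terminal) (y : ℝ) : ℝ :=
  if y ≤ P.D P.T then sInf {t : ℝ | t ∈ Set.Icc 0 P.T ∧ y ≤ P.D t} else P.T

/-- Feasible solutions of the problem with returns and `S` shuttles: `d j` and `y j`, for `j ≥ 1`,
are the time of the `j`-th departure and the cumulative load after it; `y 0 = 0`, and `d 0` plays
no role. -/
structure Feasible (P : Terminal) (S : ℕ) (d y : ℕ → ℝ) : Prop where
  zero : y 0 = 0
  nonneg : ∀ j, 1 ≤ j → 0 ≤ d j ∧ 0 ≤ y j
  capacity : ∀ j, 1 ≤ j → y j - y (j - 1) ≤ P.C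
  load_mono : ∀ j, 1 ≤ j → y (j - 1) ≤ y j
  no_overtaking : ∀ j, 2 ≤ j → d (j - 1) ≤ d j
  all_leave : Tendsto y atTop (𝓝 (P.D P.T))
  loading : ∀ j, 1 ≤ j → P.tauBar (y j) + P.ν * (y j - y (j - 1)) ≤ d j
  return_trip : ∀ j, 1 ≤ j → d j + P.π + P.ν * (y (j + S) - y (j + S - 1)) ≤ d (j + S)

/-- The maximum waiting time: the supremum, over the nonempty departures `j ≥ 1`, of
`d j - τ (y (j - 1))`; it may be infinite. -/
def gmax (P : Terminal) (d y : ℕ → ℝ) : EReal :=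
  ⨆ j ∈ {j : ℕ | 1 ≤ j ∧ y (j - 1) < y j}, ((d j - P.tau (y (j - 1)) : ℝ) : EReal)

/-- The optimal value of the problem with returns and `S` shuttles. -/
def opt (P : Terminal) (S : ℕ) : EReal :=
  ⨅ s ∈ {s : (ℕ → ℝ) × (ℕ → ℝ) | P.Feasible S s.1 s.2}, P.gmax s.1 s.2

/-- Restriction of a time to `[0, T]`. -/
def clamp (P : Terminal) (t : ℝ) : ℝ := max 0 (min t P.T)

/-- The quantity `sup {y : τ̄(y) + ν y ≤ a}`, where `y` ranges over `[0, D(T)]`. -/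
def maxLoad (P : Terminal) (a : ℝ) : ℝ :=
  sSup {y : ℝ | y ∈ Set.Icc 0 (P.D P.T) ∧ P.tauBar y + P.ν * y ≤ a}

end Terminal

/-! ## The computational model

A real random access machine in structured form. The memory consists of arrays of natural numbers
and arrays of real numbers. Natural numbers can be added, subtracted (with truncation) and
compared; real numbers can be added, subtracted, multiplied, divided and compared. The constants
of the model and the listed evaluations of the demand function are available as unit-cost
operations. A program contains no real literal, and there is no rounding operation. -/

/-- A memory: cell `i` of the array `a` of natural, resp. real, numbers. -/
structure Memory where
  nat : ℕ → ℕ → ℕ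
  real : ℕ → ℕ → ℝ

/-- Expressions with a natural value. -/
inductive NatExp where
  | lit (n : ℕ)
  | get (a : ℕ) (i : NatExp)
  | add (e f : NatExp)
  | sub (e f : NatExp)

/-- Expressions with a real value. -/
inductive RealExp where
  | ofNat (e : NatExp)
  | get (a : ℕ) (i : NatExp)
  | add (e f : RealExp)
  | sub (e f : RealExp)
  | mul (e f : RealExp)
  | div (e f : RealExp)
  | capacity
  | period
  | loadingRate
  | returnTime
  | demand (e : RealExp)
  | demandIntegral (e f : RealExp)
  | tau (e : RealExp)
  | tauBar (e : RealExp)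
  | maxLoad (e : RealExp)

/-- Tests. -/
inductive Test where
  | natLt (e f : NatExp)
  | realLt (e f : RealExp)
  | not (b : Test)
  | and (b c : Test)

/-- Programs. -/
inductive Program where
  | skip
  | setNat (a : ℕ) (i e : NatExp)
  | setReal (a : ℕ) (i : NatExp) (e : RealExp)
  | seq (p q : Program)
  | ite (b : Test) (p q : Program)
  | while (b : Test) (p : Program)

namespace NatExp

def eval (σ : Memory) : NatExp → ℕ
  | lit n => n
  | get a i => σ.nat a (i.eval σ)
  | add e f => e.eval σ + f.eval σ
  | sub e f => e.eval σ - f.eval σ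

/-- Number of operations performed by an evaluation. -/
def cost : NatExp → ℕ
  | lit _ => 1
  | get _ i => i.cost + 1
  | add e f => e.cost + f.cost + 1
  | sub e f => e.cost + f.cost + 1

end NatExp

namespace RealExp

def eval (P : Terminal) (σ : Memory) : RealExp → ℝ
  | ofNat e => (e.eval σ : ℝ)
  | get a i => σ.real a (i.eval σ)
  | add e f => e.eval P σ + f.eval P σ
  | sub e f => e.eval P σ - f.eval P σ
  | mul e f => e.eval P σ * f.eval P σ
  | div e f => e.eval P σ / f.eval P σ
  | capacity => P.C
  | period => P.T
  | loadingRate => P.ν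
  | returnTime => P.π
  | demand e => P.D (P.clamp (e.eval P σ))
  | demandIntegral e f => ∫ t in (P.clamp (e.eval P σ))..(P.clamp (f.eval P σ)), P.D t
  | tau e => P.tau (e.eval P σ)
  | tauBar e => P.tauBar (e.eval P σ)
  | maxLoad e => P.maxLoad (e.eval P σ)

/-- Number of operations performed by an evaluation. -/
def cost : RealExp → ℕ
  | ofNat e => e.cost + 1
  | get _ i => i.cost + 1
  | add e f => e.cost + f.cost + 1
  | sub e f => e.cost + f.cost + 1
  | mul e f => e.cost + f.cost + 1
  | div e f => e.cost + f.cost + 1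
  | capacity => 1
  | period => 1
  | loadingRate => 1
  | returnTime => 1
  | demand e => e.cost + 1
  | demandIntegral e f => e.cost + f.cost + 1
  | tau e => e.cost + 1
  | tauBar e => e.cost + 1
  | maxLoad e => e.cost + 1

end RealExp

namespace Test

def Holds (P : Terminal) (σ : Memory) : Test → Prop
  | natLt e f => e.eval σ < f.eval σ
  | realLt e f => e.eval P σ < f.eval P σ
  | not b => ¬ b.Holds P σ
  | and b c => b.Holds P σ ∧ c.Holds P σ

/-- Number of operations performed by an evaluation. -/
def cost : Test → ℕ
  | natLt e f => e.cost + f.cost + 1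
  | realLt e f => e.cost + f.cost + 1
  | not b => b.cost + 1
  | and b c => b.cost + c.cost + 1

end Test

namespace Memory

def setNat (σ : Memory) (a i n : ℕ) : Memory where
  nat := fun b k => if b = a ∧ k = i then n else σ.nat b k
  real := σ.real

def setReal (σ : Memory) (a i : ℕ) (x : ℝ) : Memory where
  nat := σ.nat
  real := fun b k => if b = a ∧ k = i then x else σ.real b k

/-- The initial memory: the inputs `S` and `M` are in the cells `0` and `1` of the natural
array `0`; every other cell holds zero. -/
def input (S M : ℕ) : Memory where
  nat := fun a i => if a = 0 ∧ i = 0 then S else if a = 0 ∧ i = 1 then M else 0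
  real := fun _ _ => 0

/-- The number `N` of departures in the output: cell `0` of the natural array `1`. -/
def outN (σ : Memory) : ℕ := σ.nat 1 0

/-- The departure times in the output: cells `1, …, N` of the real array `0`; the departures
after the `N`-th one follow each other at distance `π`. -/
def outD (P : Terminal) (σ : Memory) (j : ℕ) : ℝ :=
  if j ≤ σ.outN then σ.real 0 j else σ.real 0 σ.outN + ((j : ℝ) - (σ.outN : ℝ)) * P.π

/-- The cumulative loads in the output: cells `1, …, N` of the real array `1`, with `0` before
the first departure; after the `N`-th departure all the users have left. -/
def outY (P : Terminal) (σ : Memory) (j : ℕ) : ℝ :=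
  if j = 0 then 0 else if j ≤ σ.outN then σ.real 1 j else P.D P.T

end Memory

/-- `Exec P p σ σ' t`: for the constants `P`, the program `p` started in the memory `σ` halts in
the memory `σ'` after `t` steps. -/
inductive Exec (P : Terminal) : Program → Memory → Memory → ℕ → Prop where
  | skip (σ : Memory) : Exec P Program.skip σ σ 1
  | setNat (σ : Memory) (a : ℕ) (i e : NatExp) :
      Exec P (Program.setNat a i e) σ (σ.setNat a (i.eval σ) (e.eval σ)) (i.cost + e.cost + 1)
  | setReal (σ : Memory) (a : ℕ) (i : NatExp) (e : RealExp) :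
      Exec P (Program.setReal a i e) σ (σ.setReal a (i.eval σ) (e.eval P σ)) (i.cost + e.cost + 1)
  | seq {p q : Program} {σ₁ σ₂ σ₃ : Memory} {s t : ℕ} :
      Exec P p σ₁ σ₂ s → Exec P q σ₂ σ₃ t → Exec P (Program.seq p q) σ₁ σ₃ (s + t)
  | ite_true {b : Test} {p q : Program} {σ σ' : Memory} {t : ℕ} :
      b.Holds P σ → Exec P p σ σ' t → Exec P (Program.ite b p q) σ σ' (b.cost + t)
  | ite_false {b : Test} {p q : Program} {σ σ' : Memory} {t : ℕ} :
      ¬ b.Holds P σ → Exec P q σ σ' t → Exec P (Program.ite b p q) σ σ' (b.cost + t)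
  | while_false {b : Test} {p : Program} {σ : Memory} :
      ¬ b.Holds P σ → Exec P (Program.while b p) σ σ b.cost
  | while_true {b : Test} {p : Program} {σ₁ σ₂ σ₃ : Memory} {s t : ℕ} :
      b.Holds P σ₁ → Exec P p σ₁ σ₂ s → Exec P (Program.while b p) σ₂ σ₃ t →
      Exec P (Program.while b p) σ₁ σ₃ (b.cost + s + t)

end Shuttle

end

/-!
The program is a dynamic program over schedules that live on two grids: cumulative loads are
multiples of `η = C / M`, cut off at `D(T)`, and departure times are multiples of `δ = π / M`,
shifted by `π + ν C`. A vertex consists of the current load and the times of the last `S`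
departures, which are the `S` digits of a number whose base is the size `O(M)` of the time grid;
before the first departure all digits are `0`, a time so early that the return trips do not
constrain anything. An arc is one departure. Along an arc of a schedule the code increases
(`window_lt_window_succ`): the digits do not decrease, and by the return time the digit that enters
is larger than the one that leaves. So one sweep over the vertices in decreasing order solves the
bottleneck equations `Terminal.Solved`. With `n ≤ (b M) ^ (S + 1)` vertices this takes `O(n²)` steps
(`reaches_schedule`, `exists_vertices_le`), and `2 S + 2 ≤ 3 S + 2`.

The path that is put out is feasible, and its waiting time is at most the computed value at the
start vertex (`Traced.feasible`, `Traced.gmax_le`). That value is compared with a feasible schedule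
of waiting time at most `w` in `Solved.le_of_feasible`. Rounding up the loads keeps the capacity
constraint, since `C` is a multiple of `η`. It delays the loading constraint by `O(1 / M)`: the
lower bound for the right derivative makes `τ̄` Lipschitz (`Terminal.tauBar_le_add`), although `D`
may jump. It also makes every lap longer by `O(1 / M)`; as a lap takes at least the time `π`,
slowing the whole schedule down by a factor `1 + O(1 / M)` absorbs this. All departures of interest lie
before `T + w`, so the waiting time grows by `O(1 / M)` only, whatever `S` is.

The Lipschitz constant is unknown to the program, so for small `M` the rounded schedule may exceed
the time horizon. Then `1 / M` is bounded below, and the schedule that sends one full shuttle after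
the other from time `T` on, which always fits (`Solved.le_crude`), is good enough.
-/

noncomputable section

namespace Shuttle

/-! ### The machine: memory and total correctness -/

theorem Memory.ext' {σ ρ : Memory} (h : ∀ a i, σ.nat a i = ρ.nat a i)
    (h' : ∀ a i, σ.real a i = ρ.real a i) : σ = ρ := by
  cases σ; cases ρ
  simp only [Memory.mk.injEq]
  exact ⟨funext fun a => funext fun i => h a i, funext fun a => funext fun i => h' a i⟩

@[simp] theorem Memory.nat_setNat (σ : Memory) (a i n b k : ℕ) :
    (σ.setNat a i n).nat b k = if b = a ∧ k = i then n else σ.nat b k := rfl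

@[simp] theorem Memory.real_setNat (σ : Memory) (a i n b k : ℕ) :
    (σ.setNat a i n).real b k = σ.real b k := rfl

@[simp] theorem Memory.nat_setReal (σ : Memory) (a i : ℕ) (x : ℝ) (b k : ℕ) :
    (σ.setReal a i x).nat b k = σ.nat b k := rfl

@[simp] theorem Memory.real_setReal (σ : Memory) (a i : ℕ) (x : ℝ) (b k : ℕ) :
    (σ.setReal a i x).real b k = if b = a ∧ k = i then x else σ.real b k := rfl

theorem Memory.setNat_setNat (σ : Memory) (a i m n : ℕ) :
    (σ.setNat a i m).setNat a i n = σ.setNat a i n := by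
  refine Memory.ext' (fun b k => ?_) fun _ _ => rfl
  simp only [Memory.nat_setNat]
  split_ifs <;> rfl

/-- Total correctness with a time bound: `p`, started in `σ`, halts after at most `c` steps in a
memory that satisfies `Q`. -/
def Reaches (P : Terminal) (p : Program) (σ : Memory) (c : ℕ) (Q : Memory → Prop) : Prop :=
  ∃ (σ' : Memory) (t : ℕ), Exec P p σ σ' t ∧ t ≤ c ∧ Q σ'

section Rules

variable {P : Terminal} {p q : Program} {b : Test} {σ : Memory} {c c' : ℕ} {Q R : Memory → Prop}

theorem Reaches.mono (h : Reaches P p σ c Q) (hc : c ≤ c') (hQ : ∀ σ', Q σ' → R σ') :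
    Reaches P p σ c' R := by
  obtain ⟨σ', t, h₁, h₂, h₃⟩ := h
  exact ⟨σ', t, h₁, h₂.trans hc, hQ _ h₃⟩

theorem reaches_setNat {a : ℕ} {i e : NatExp} (hc : i.cost + e.cost + 1 ≤ c)
    (h : Q (σ.setNat a (i.eval σ) (e.eval σ))) : Reaches P (.setNat a i e) σ c Q :=
  ⟨_, _, .setNat σ a i e, hc, h⟩

theorem Reaches.seq (h : Reaches P p σ c fun σ' => Reaches P q σ' c' Q) :
    Reaches P (.seq p q) σ (c + c') Q := by
  obtain ⟨σ₁, s, h₁, hs, σ₂, t, h₂, ht, hQ⟩ := h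
  exact ⟨σ₂, s + t, .seq h₁ h₂, add_le_add hs ht, hQ⟩

/-- A loop whose invariant is `I` and along which the variant `μ` decreases. -/
theorem reaches_while (I : Memory → Prop) (μ : Memory → ℕ)
    (hbody : ∀ σ, I σ → b.Holds P σ → Reaches P p σ c fun σ' => I σ' ∧ μ σ' < μ σ)
    (hexit : ∀ σ, I σ → ¬ b.Holds P σ → Q σ) (hσ : I σ) :
    Reaches P (.while b p) σ ((b.cost + c) * μ σ + b.cost) Q := by
  induction hk : μ σ using Nat.strong_induction_on generalizing σ with
  | _ k ih =>
    by_cases hb : b.Holds P σ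
    · obtain ⟨σ₁, s, h₁, hs, hI, hμ⟩ := hbody σ hσ hb
      obtain ⟨σ₂, t, h₂, ht, hQ⟩ := ih (μ σ₁) (hk ▸ hμ) hI rfl
      refine ⟨σ₂, _, .while_true hb h₁ h₂, ?_, hQ⟩
      have : (b.cost + c) * (μ σ₁ + 1) ≤ (b.cost + c) * k := Nat.mul_le_mul_left _ (by omega)
      rw [mul_add, mul_one] at this
      omega
    · exact ⟨σ, _, .while_false hb, by omega, hexit σ hσ hb⟩

end Rules

/-! ### Loop-free programs -/

open Classical in
/-- The effect of a loop-free program on the memory. -/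
def Program.apply (P : Terminal) : Program → Memory → Memory
  | skip, σ => σ
  | setNat a i e, σ => σ.setNat a (i.eval σ) (e.eval σ)
  | setReal a i e, σ => σ.setReal a (i.eval σ) (e.eval P σ)
  | seq p q, σ => q.apply P (p.apply P σ)
  | ite b p q, σ => if b.Holds P σ then p.apply P σ else q.apply P σ
  | .while _ _, σ => σ

theorem Program.apply_ite_of_holds {P : Terminal} {b : Test} {p q : Program} {σ : Memory}
    (h : b.Holds P σ) : (Program.ite b p q).apply P σ = p.apply P σ := if_pos h

theorem Program.apply_ite_of_not_holds {P : Terminal} {b : Test} {p q : Program} {σ : Memory}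
    (h : ¬ b.Holds P σ) : (Program.ite b p q).apply P σ = q.apply P σ := if_neg h

theorem Program.apply_seq {P : Terminal} {p q : Program} {σ : Memory} :
    (Program.seq p q).apply P σ = q.apply P (p.apply P σ) := rfl

/-- A bound on the number of steps of a loop-free program. -/
def Program.maxCost : Program → ℕ
  | skip => 1
  | setNat _ i e => i.cost + e.cost + 1
  | setReal _ i e => i.cost + e.cost + 1
  | seq p q => p.maxCost + q.maxCost
  | ite b p q => b.cost + (p.maxCost + q.maxCost)
  | .while _ _ => 0

/-- The program contains no loop, so that its effect is the function `Program.apply`. -/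
def Program.LoopFree : Program → Prop
  | seq p q => p.LoopFree ∧ q.LoopFree
  | ite _ p q => p.LoopFree ∧ q.LoopFree
  | .while _ _ => False
  | _ => True

theorem Program.LoopFree.exec {P : Terminal} {p : Program} (hp : p.LoopFree) (σ : Memory) :
    ∃ t ≤ p.maxCost, Exec P p σ (p.apply P σ) t := by
  induction p generalizing σ with
  | skip => exact ⟨_, le_rfl, .skip σ⟩
  | setNat a i e => exact ⟨_, le_rfl, .setNat σ a i e⟩
  | setReal a i e => exact ⟨_, le_rfl, .setReal σ a i e⟩
  | seq p q ihp ihq =>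
    obtain ⟨s, hs, h₁⟩ := ihp hp.1 σ
    obtain ⟨t, ht, h₂⟩ := ihq hp.2 (p.apply P σ)
    exact ⟨_, add_le_add hs ht, .seq h₁ h₂⟩
  | ite b p q ihp ihq =>
    obtain ⟨s, hs, h₁⟩ := ihp hp.1 σ
    obtain ⟨t, ht, h₂⟩ := ihq hp.2 σ
    by_cases hb : b.Holds P σ
    · refine ⟨b.cost + s, ?_, ?_⟩
      · simp only [maxCost]; omega
      · simpa only [apply, if_pos hb] using Exec.ite_true hb h₁
    · refine ⟨b.cost + t, ?_, ?_⟩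
      · simp only [maxCost]; omega
      · simpa only [apply, if_neg hb] using Exec.ite_false hb h₂
  | _ => exact hp.elim

theorem Program.LoopFree.reaches {P : Terminal} {p : Program} (hp : p.LoopFree) {σ : Memory}
    {c : ℕ} {Q : Memory → Prop} (hc : p.maxCost ≤ c) (h : Q (p.apply P σ)) :
    Reaches P p σ c Q := by
  obtain ⟨t, ht, h'⟩ := hp.exec (P := P) σ
  exact ⟨_, t, h', ht.trans hc, h⟩

/-! ### Rounding, multiplication and division on the machine -/

/-- The scalar variable number `k`: the cell `k` of the natural array `2`. -/
abbrev NatExp.var (k : ℕ) : NatExp := .get 2 (.lit k)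

/-- Assignment to the scalar variable number `k`. -/
abbrev Program.setVar (k : ℕ) (e : NatExp) : Program := .setNat 2 (.lit k) e

/-- Computes `⌈f / e⌉₊` in the variable `k` by trying the numbers one after the other. -/
def Program.ceilDiv (k : ℕ) (e f : RealExp) : Program :=
  .seq (.setVar k (.lit 0))
    (.while (.realLt (.mul (.ofNat (.var k)) e) f) (.setVar k (.add (.var k) (.lit 1))))

theorem reaches_ceilDiv {P : Terminal} {σ : Memory} {k : ℕ} {e f : RealExp} {x y : ℝ}
    {Q : Memory → Prop} (hx : 0 < x) (he : ∀ m, e.eval P (σ.setNat 2 k m) = x)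
    (hf : ∀ m, f.eval P (σ.setNat 2 k m) = y) (h : Q (σ.setNat 2 k ⌈y / x⌉₊)) :
    Reaches P (.ceilDiv k e f) σ ((e.cost + f.cost + 12) * (⌈y / x⌉₊ + 1)) Q := by
  have key : Reaches P (.ceilDiv k e f) σ _ Q :=
    Reaches.seq (c' := (e.cost + f.cost + 11) * ⌈y / x⌉₊ + (e.cost + f.cost + 5)) <|
    reaches_setNat (c := 3) (by simp [NatExp.cost]) <|
    (reaches_while (c := 6)
      (fun σ' => ∃ m ≤ ⌈y / x⌉₊, σ' = σ.setNat 2 k m) (fun σ' => ⌈y / x⌉₊ - σ'.nat 2 k)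
      (by
        rintro _ ⟨m, -, rfl⟩ hb
        simp only [Test.Holds, RealExp.eval, he, hf, NatExp.eval, Memory.nat_setNat, and_self,
          if_true] at hb
        have hm : m < ⌈y / x⌉₊ := Nat.lt_ceil.2 ((lt_div_iff₀ hx).2 hb)
        refine reaches_setNat (by simp [NatExp.cost]) ⟨⟨m + 1, hm, ?_⟩, ?_⟩
        · simp [NatExp.eval, Memory.setNat_setNat]
        · simp [NatExp.eval]; omega)
      (by
        rintro _ ⟨m, hm, rfl⟩ hb
        simp only [Test.Holds, RealExp.eval, he, hf, NatExp.eval, Memory.nat_setNat, and_self,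
          if_true, not_lt] at hb
        have : ⌈y / x⌉₊ ≤ m := Nat.ceil_le.2 ((div_le_iff₀ hx).2 hb)
        rwa [le_antisymm hm this])
      ⟨0, Nat.zero_le _, rfl⟩).mono
      (by
        simp only [Test.cost, RealExp.cost, NatExp.cost, Memory.nat_setNat,
          and_self, if_true, Nat.sub_zero]
        apply le_of_eq; ring)
      fun _ h => h
  exact key.mono (by nlinarith) fun _ h => h

/-- Computes the product of the variables `i` and `j` in the variable `r` by repeated addition;
the variable `k` is the counter. -/
def Program.mul (r k i j : ℕ) : Program :=
  .seq (.seq (.setVar r (.lit 0)) (.setVar k (.lit 0)))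
    (.while (.natLt (.var k) (.var j))
      (.seq (.setVar r (.add (.var r) (.var i))) (.setVar k (.add (.var k) (.lit 1)))))

theorem reaches_mul {P : Terminal} {σ : Memory} {r k i j : ℕ} {Q : Memory → Prop}
    (hrk : r ≠ k) (hir : i ≠ r) (hik : i ≠ k) (hjr : j ≠ r) (hjk : j ≠ k)
    (h : Q ((σ.setNat 2 r (σ.nat 2 i * σ.nat 2 j)).setNat 2 k (σ.nat 2 j))) :
    Reaches P (.mul r k i j) σ (24 * (σ.nat 2 j + 1)) Q := by
  have key : Reaches P (.mul r k i j) σ _ Q :=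
    Reaches.seq (c' := 18 * σ.nat 2 j + 5) <|
    Program.LoopFree.reaches (c := 6) (by simp [Program.LoopFree])
      (by simp [Program.maxCost, NatExp.cost]) <|
    (reaches_while (c := 13)
      (fun σ' => ∃ m ≤ σ.nat 2 j, σ' = (σ.setNat 2 r (σ.nat 2 i * m)).setNat 2 k m)
      (fun σ' => σ.nat 2 j - σ'.nat 2 k)
      (by
        rintro _ ⟨m, -, rfl⟩ hb
        simp [Test.Holds, NatExp.eval, hjr, hjk] at hb
        refine Program.LoopFree.reaches (by simp [Program.LoopFree])
          (by simp [Program.maxCost, NatExp.cost]) ⟨⟨m + 1, hb, ?_⟩, ?_⟩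
        · simp only [Program.apply, NatExp.eval, Memory.nat_setNat]
          refine Memory.ext' (fun b l => ?_) fun _ _ => rfl
          simp [hrk, hir, hik, hrk.symm, mul_add]
          split_ifs <;> rfl
        · simp [Program.apply, NatExp.eval, hrk.symm]; omega)
      (by
        rintro _ ⟨m, hm, rfl⟩ hb
        simp [Test.Holds, NatExp.eval, hjr, hjk] at hb
        rwa [le_antisymm hm hb])
      ⟨0, Nat.zero_le _, rfl⟩).mono
      (by simp [Test.cost, NatExp.cost])
      fun _ h => h
  exact key.mono (by omega) fun _ h => h

/-- Computes the quotient, in the variable `a`, and the remainder, in the variable `r`, of the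
variables `i` and `j` by repeated subtraction. -/
def Program.divMod (a r i j : ℕ) : Program :=
  .seq (.seq (.setVar a (.lit 0)) (.setVar r (.var i)))
    (.while (.not (.natLt (.var r) (.var j)))
      (.seq (.setVar r (.sub (.var r) (.var j))) (.setVar a (.add (.var a) (.lit 1)))))

theorem reaches_divMod {P : Terminal} {σ : Memory} {a r i j : ℕ} {Q : Memory → Prop}
    (har : a ≠ r) (hia : i ≠ a) (hja : j ≠ a) (hjr : j ≠ r) (hj : 0 < σ.nat 2 j)
    (h : Q ((σ.setNat 2 a (σ.nat 2 i / σ.nat 2 j)).setNat 2 r (σ.nat 2 i % σ.nat 2 j))) :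
    Reaches P (.divMod a r i j) σ (26 * (σ.nat 2 i + 1)) Q := by
  have key : Reaches P (.divMod a r i j) σ _ Q :=
    Reaches.seq (c' := 19 * σ.nat 2 i + 6) <|
    Program.LoopFree.reaches (c := 7) (by simp [Program.LoopFree])
      (by simp [Program.maxCost, NatExp.cost]) <|
    (reaches_while (c := 13)
      (fun σ' => ∃ m l, σ.nat 2 i = σ.nat 2 j * m + l ∧ σ' = (σ.setNat 2 a m).setNat 2 r l)
      (fun σ' => σ'.nat 2 r)
      (by
        rintro _ ⟨m, l, hml, rfl⟩ hb
        simp [Test.Holds, NatExp.eval, hjr, hja] at hb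
        refine Program.LoopFree.reaches (by simp [Program.LoopFree])
          (by simp [Program.maxCost, NatExp.cost])
          ⟨⟨m + 1, l - σ.nat 2 j, ?_, ?_⟩, ?_⟩
        · rw [hml, mul_add]; omega
        · simp only [Program.apply, NatExp.eval, Memory.nat_setNat]
          refine Memory.ext' (fun b l => ?_) fun _ _ => rfl
          simp [har, hjr, hja]
          split_ifs <;> grind
        · simp [Program.apply, NatExp.eval, har.symm, hjr, hja]; omega)
      (by
        rintro _ ⟨m, l, hml, rfl⟩ hb
        simp [Test.Holds, NatExp.eval, hjr, hja] at hb
        have h₁ : σ.nat 2 i / σ.nat 2 j = m := by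
          rw [hml, Nat.mul_add_div hj, Nat.div_eq_of_lt hb, add_zero]
        have h₂ : σ.nat 2 i % σ.nat 2 j = l := by
          rw [hml, Nat.mul_add_mod, Nat.mod_eq_of_lt hb]
        rwa [h₁, h₂] at h)
      ⟨0, σ.nat 2 i, by simp, by simp [Program.apply, NatExp.eval, hia]⟩).mono
      (by simp [Program.apply, Test.cost, NatExp.cost, NatExp.eval, hia])
      fun _ h => h
  exact key.mono (by omega) fun _ h => h

/-! ### The network of vertices and its dynamic programming equations -/

namespace Terminal

/-- The number of users. -/
def total (P : Terminal) : ℝ := P.D P.T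

/-- A departure at the time `-dead` does not delay any departure at a nonnegative time. -/
def dead (P : Terminal) : ℝ := P.π + P.ν * P.C

/-- The latest departure time that is considered: large enough for the schedule that sends one
full shuttle after the other once all users have arrived, and for every better schedule. -/
def horizon (P : Terminal) : ℝ :=
  P.T + P.T + (P.total / P.C + 1) * (P.π + P.π + P.ν * P.C) + P.π + P.π

/-- Number of points of the time grid. -/
def base (P : Terminal) (M : ℕ) : ℕ := ⌈(P.horizon + P.dead) / (P.π / M)⌉₊

/-- Index of the last point of the load grid. -/
def top (P : Terminal) (M : ℕ) : ℕ := ⌈P.total / (P.C / M)⌉₊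

/-- The time grid has step `π / M` and starts at `-dead`, which stands for shuttles that have not
left yet. -/
def gridTime (P : Terminal) (M k : ℕ) : ℝ := k * (P.π / M) - P.dead

/-- The load grid has step `C / M`, so that the capacity is a multiple of the step; it is cut off
at the total demand. -/
def gridLoad (P : Terminal) (M i : ℕ) : ℝ := min (i * (P.C / M)) P.total

/-- Number of vertices: a vertex codes the times of the last `S` departures, as the `S` digits of
a number in base `base P M`, and the current load. -/
def vertices (P : Terminal) (S M : ℕ) : ℕ := P.base M ^ S * (P.top M + 1)

/-- The digits of a vertex; the most recent departure is the lowest digit. -/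
def code (P : Terminal) (M u : ℕ) : ℕ := u / (P.top M + 1)

/-- All departures of a vertex except the most recent one. -/
def older (P : Terminal) (M u : ℕ) : ℕ := P.code M u / P.base M

/-- All departures of a vertex except the oldest one. -/
def newer (P : Terminal) (S M u : ℕ) : ℕ := P.code M u % P.base M ^ (S - 1)

/-- Time of the most recent departure of a vertex. -/
def newest (P : Terminal) (M u : ℕ) : ℝ := P.gridTime M (P.code M u % P.base M)

/-- Time of the oldest departure of a vertex. -/
def oldest (P : Terminal) (S M u : ℕ) : ℝ := P.gridTime M (P.code M u / P.base M ^ (S - 1))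

/-- Cumulative load of a vertex. -/
def load (P : Terminal) (M u : ℕ) : ℝ := P.gridLoad M (u % (P.top M + 1))

/-- One departure leads from `u` to `v`. The condition `u < v` makes the network acyclic; it is
automatic for the departures of a schedule. -/
structure Arc (P : Terminal) (S M u v : ℕ) : Prop where
  lt : u < v
  lt_vertices : v < P.vertices S M
  unfinished : P.load M u < P.total
  shift : P.older M v = P.newer S M u
  load_mono : P.load M u ≤ P.load M v
  capacity : P.load M v - P.load M u ≤ P.C
  no_overtaking : P.newest M u ≤ P.newest M v
  loading : P.tauBar (P.load M v) + P.ν * (P.load M v - P.load M u) ≤ P.newest M v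
  return_trip : P.oldest S M u + P.π + P.ν * (P.load M v - P.load M u) ≤ P.newest M v

/-- The bottleneck of a path that starts with the departure from `u` to `v` and goes on with
bottleneck `V v`. Empty departures do not count. -/
def bottleneck (P : Terminal) (M : ℕ) (V : ℕ → ℝ) (u v : ℕ) : ℝ :=
  if P.load M u < P.load M v ∧ V v < P.newest M v - P.tau (P.load M u) then
    P.newest M v - P.tau (P.load M u) else V v

/-- The dynamic programming equation at `u`, restricted to the arcs to vertices `v < m`: `V u` is
the least bottleneck of such an arc, or the horizon if there is none better, and `next u` is the
end of a best arc. Vertices with full load have the value `0`. -/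
structure SolvedAt (P : Terminal) (S M : ℕ) (V : ℕ → ℝ) (next : ℕ → ℕ) (u m : ℕ) : Prop where
  final : ¬ P.load M u < P.total → V u = 0
  arc : P.load M u < P.total → V u < P.horizon →
    P.Arc S M u (next u) ∧ P.bottleneck M V u (next u) ≤ V u
  le : ∀ v < m, P.Arc S M u v → V u ≤ P.bottleneck M V u v

/-- The dynamic programming equations at all vertices. -/
def Solved (P : Terminal) (S M : ℕ) (V : ℕ → ℝ) (next : ℕ → ℕ) : Prop :=
  ∀ u < P.vertices S M, P.SolvedAt S M V next u (P.vertices S M)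

variable {P : Terminal} {S M : ℕ} {V V' : ℕ → ℝ} {next next' : ℕ → ℕ} {u v m : ℕ}

theorem bottleneck_congr (h : V v = V' v) : P.bottleneck M V u v = P.bottleneck M V' u v := by
  simp only [bottleneck, h]

theorem le_bottleneck : V v ≤ P.bottleneck M V u v := by
  unfold bottleneck; split_ifs with h
  · exact h.2.le
  · exact le_rfl

theorem wait_le_bottleneck (h : P.load M u < P.load M v) :
    P.newest M v - P.tau (P.load M u) ≤ P.bottleneck M V u v := by
  unfold bottleneck; split_ifs with h'
  · exact le_rfl
  · exact not_lt.1 fun h'' => h' ⟨h, h''⟩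

/-- The equation at `u` involves only the values at `u` and at later vertices. -/
theorem SolvedAt.congr (h : P.SolvedAt S M V next u m) (hV : ∀ v, u ≤ v → V' v = V v)
    (hn : next' u = next u) : P.SolvedAt S M V' next' u m where
  final hu := by rw [hV u le_rfl, h.final hu]
  arc hu hH := by
    rw [hV u le_rfl] at hH ⊢
    obtain ⟨ha, hb⟩ := h.arc hu hH
    rw [hn]
    exact ⟨ha, by rwa [bottleneck_congr (hV _ ha.lt.le)]⟩
  le v hv ha := by
    rw [hV u le_rfl, bottleneck_congr (hV _ ha.lt.le)]
    exact h.le v hv ha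

end Terminal

/-! ### The program: grids, powers of the base and tables -/

namespace RealExp

/-- The number `M` as a real number. -/
abbrev fineness : RealExp := .ofNat (.get 0 (.lit 1))

abbrev timeStep : RealExp := .div .returnTime fineness

abbrev loadStep : RealExp := .div .capacity fineness

abbrev total : RealExp := .demand .period

abbrev dead : RealExp := .add .returnTime (.mul .loadingRate .capacity)

abbrev horizon : RealExp :=
  .add (.add (.add (.add .period .period)
    (.mul (.add (.div total .capacity) (.ofNat (.lit 1)))
      (.add (.add .returnTime .returnTime) (.mul .loadingRate .capacity)))) .returnTime)
    .returnTime

abbrev gridTime (k : ℕ) : RealExp := .sub (.mul (.ofNat (.var k)) timeStep) dead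

end RealExp

namespace Program

/-- Stores the base in the variable `0` and the number of points of the load grid in the
variable `1`. -/
def gridSizes : Program :=
  .seq (.ceilDiv 0 .timeStep (.add .horizon .dead))
    (.seq (.ceilDiv 1 .loadStep .total) (.setVar 1 (.add (.var 1) (.lit 1))))

/-- Stores the `S`-th power of the base in the variable `2` and the `(S - 1)`-th one in the
variable `3`. -/
def powers : Program :=
  .seq (.seq (.setVar 2 (.lit 1)) (.setVar 5 (.lit 0)))
    (.while (.natLt (.var 5) (.get 0 (.lit 0)))
      (.seq (.setVar 3 (.var 2)) (.seq (.mul 6 7 2 0)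
        (.seq (.setVar 2 (.var 6)) (.setVar 5 (.add (.var 5) (.lit 1)))))))

/-- Writes the attributes of the vertex in the variable `8`, whose load index is in the variable
`10` and whose digits are in the variables `11`, …, `14`, and passes to the next vertex. -/
def tableEntries : Program :=
  .seq (.setNat 3 (.var 8) (.var 11)) <|
  .seq (.setNat 4 (.var 8) (.var 14)) <|
  .seq (.setReal 2 (.var 8) (.gridTime 12)) <|
  .seq (.setReal 3 (.var 8) (.gridTime 13)) <|
  .seq (.setReal 4 (.var 8) (.mul (.ofNat (.var 10)) .loadStep)) <|
  .seq (.ite (.realLt .total (.get 4 (.var 8))) (.setReal 4 (.var 8) .total) .skip) <|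
  .setVar 8 (.add (.var 8) (.lit 1))

/-- Writes the attributes of the vertices, whose number is in the variable `4`, into the natural
arrays `3` and `4` and the real arrays `2`, `3` and `4`. -/
def tables : Program :=
  .seq (.setVar 8 (.lit 0))
    (.while (.natLt (.var 8) (.var 4))
      (.seq (.divMod 9 10 8 1) <| .seq (.divMod 11 12 9 0) <| .seq (.divMod 13 14 9 3)
        tableEntries))

end Program

/-- The tables describe the vertices with number less than `m`. -/
structure Tabulated (P : Terminal) (S M m : ℕ) (σ : Memory) : Prop where
  older : ∀ u < m, σ.nat 3 u = P.older M u
  newer : ∀ u < m, σ.nat 4 u = P.newer S M u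
  newest : ∀ u < m, σ.real 2 u = P.newest M u
  oldest : ∀ u < m, σ.real 3 u = P.oldest S M u
  load : ∀ u < m, σ.real 4 u = P.load M u

variable {P : Terminal} {S M : ℕ} {σ : Memory}

theorem clamp_period (hP : P.Standing) : P.clamp P.T = P.T := by
  simp [Terminal.clamp, hP.T_pos.le]

theorem eval_total (hP : P.Standing) : RealExp.total.eval P σ = P.total := by
  simp [RealExp.eval, clamp_period hP, Terminal.total]

theorem eval_dead : RealExp.dead.eval P σ = P.dead := rfl

theorem eval_horizon (hP : P.Standing) : RealExp.horizon.eval P σ = P.horizon := by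
  simp [RealExp.eval, NatExp.eval, clamp_period hP, Terminal.horizon, Terminal.total]

theorem reaches_gridSizes (hP : P.Standing) (hπ : 0 < P.π) (hM : 1 ≤ M) :
    Reaches P .gridSizes (.input S M) (100 * (P.base M + P.top M + 2)) fun σ =>
      σ.nat 0 0 = S ∧ σ.nat 0 1 = M ∧ σ.nat 2 0 = P.base M ∧ σ.nat 2 1 = P.top M + 1 := by
  have hM' : (0 : ℝ) < M := by exact_mod_cast hM
  refine Reaches.mono (Reaches.seq (c' := 30 * (P.top M + 1) + 10)
    (reaches_ceilDiv (x := P.π / M) (y := P.horizon + P.dead) (div_pos hπ hM') ?_ ?_ <|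
      Reaches.mono (Reaches.seq (c' := 6)
        (reaches_ceilDiv (x := P.C / M) (y := P.total) (div_pos hP.C_pos hM') ?_ ?_ <|
          reaches_setNat ?_ ?_)) (c' := _) ?_ fun _ h => h)) ?_ fun _ h => h
  · intro m; simp [RealExp.eval, NatExp.eval, Memory.input]
  · intro m
    rw [← eval_horizon hP (σ := (Memory.input S M).setNat 2 0 m),
      ← eval_dead (σ := (Memory.input S M).setNat 2 0 m)]
    rfl
  · intro m; simp [RealExp.eval, NatExp.eval, Memory.input]
  · intro m; exact eval_total hP
  · simp [NatExp.cost]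
  · simp [NatExp.eval, Memory.input, Terminal.base, Terminal.top]
  · simp only [RealExp.cost, NatExp.cost]; rw [Terminal.top]; omega
  · simp only [RealExp.cost, NatExp.cost]; rw [Terminal.base]; omega

theorem reaches_powers {B I : ℕ} (hS : 1 ≤ S) (h₀ : σ.nat 0 0 = S) (h₁ : σ.nat 0 1 = M)
    (h₂ : σ.nat 2 0 = B) (h₃ : σ.nat 2 1 = I) :
    Reaches P .powers σ (60 * (B + 2) * (S + 1)) fun σ =>
      σ.nat 0 1 = M ∧ σ.nat 2 0 = B ∧ σ.nat 2 1 = I ∧ σ.nat 2 2 = B ^ S ∧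
        σ.nat 2 3 = B ^ (S - 1) := by
  refine Reaches.mono (c := 6 + ((5 + (24 * (B + 1) + 20)) * S + 5)) (Reaches.seq <|
    Program.LoopFree.reaches (by simp [Program.LoopFree])
      (by simp [Program.maxCost, NatExp.cost]) <| Reaches.mono
    (reaches_while (c := 24 * (B + 1) + 20)
      (fun σ => ∃ s ≤ S, σ.nat 0 0 = S ∧ σ.nat 0 1 = M ∧ σ.nat 2 0 = B ∧ σ.nat 2 1 = I ∧
        σ.nat 2 5 = s ∧ σ.nat 2 2 = B ^ s ∧ (1 ≤ s → σ.nat 2 3 = B ^ (s - 1)))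
      (fun σ => S - σ.nat 2 5) ?_ ?_ ?_) ?_ fun _ h => h) ?_ fun _ h => h
  · rintro σ ⟨s, hs, h₀, h₁, h₂, h₃, h₅, h₆, h₇⟩ hb
    simp only [Test.Holds, NatExp.eval, h₅, h₀] at hb
    refine Reaches.mono (Reaches.seq (c := 4) <| reaches_setNat (by simp [NatExp.cost]) <|
      Reaches.seq (c' := 10) <| reaches_mul (by decide) (by decide) (by decide) (by decide)
        (by decide) <| Program.LoopFree.reaches (by simp [Program.LoopFree])
        (by simp [Program.maxCost, NatExp.cost]) ?_) ?_ fun _ h => h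
    · simp only [Program.apply, NatExp.eval, Memory.nat_setNat]
      norm_num [h₀, h₁, h₂, h₃, h₅, h₆]
      exact ⟨⟨s + 1, hb, rfl, pow_succ B s, fun _ => rfl⟩, by omega⟩
    · simp [NatExp.eval, h₂]; omega
  · rintro σ ⟨s, hs, h₀, h₁, h₂, h₃, h₅, h₆, h₇⟩ hb
    simp only [Test.Holds, NatExp.eval, h₅, h₀] at hb
    obtain rfl : s = S := by omega
    exact ⟨h₁, h₂, h₃, h₆, h₇ hS⟩
  · exact ⟨0, Nat.zero_le _, by simp [Program.apply, NatExp.eval, *]⟩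
  · simp [Program.apply, Test.cost, NatExp.cost, NatExp.eval]
  · nlinarith [Nat.zero_le (B * S)]

theorem Tabulated.congr {σ' : Memory} {m : ℕ} (h : Tabulated P S M m σ)
    (h₃ : ∀ u < m, σ'.nat 3 u = σ.nat 3 u) (h₄ : ∀ u < m, σ'.nat 4 u = σ.nat 4 u)
    (hr : ∀ a u, a ∈ ({2, 3, 4} : Set ℕ) → u < m → σ'.real a u = σ.real a u) :
    Tabulated P S M m σ' where
  older u hu := by rw [h₃ u hu, h.older u hu]
  newer u hu := by rw [h₄ u hu, h.newer u hu]
  newest u hu := by rw [hr 2 u (by simp) hu, h.newest u hu]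
  oldest u hu := by rw [hr 3 u (by simp) hu, h.oldest u hu]
  load u hu := by rw [hr 4 u (by simp) hu, h.load u hu]

theorem apply_tableEntries {u : ℕ} (hP : P.Standing) (h₁ : σ.nat 0 1 = M) (h₈ : σ.nat 2 8 = u)
    (h₁₀ : σ.nat 2 10 = u % (P.top M + 1)) (h₁₁ : σ.nat 2 11 = P.older M u)
    (h₁₂ : σ.nat 2 12 = P.code M u % P.base M)
    (h₁₃ : σ.nat 2 13 = P.code M u / P.base M ^ (S - 1)) (h₁₄ : σ.nat 2 14 = P.newer S M u) :
    Program.tableEntries.apply P σ = (((((σ.setNat 3 u (P.older M u)).setNat 4 u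
      (P.newer S M u)).setReal 2 u (P.newest M u)).setReal 3 u (P.oldest S M u)).setReal 4 u
      (P.load M u)).setNat 2 8 (u + 1) := by
  have htot : P.D (P.clamp P.T) = P.total := by rw [clamp_period hP]; rfl
  have hload : P.load M u = min ((u % (P.top M + 1) : ℕ) * (P.C / M)) P.total := rfl
  by_cases hb : P.total < (u % (P.top M + 1) : ℕ) * (P.C / M)
  · rw [min_eq_right hb.le] at hload
    simp [Program.tableEntries, Program.apply, Test.Holds, RealExp.eval, NatExp.eval,
      h₁, h₈, h₁₀, h₁₁, h₁₂, h₁₃, h₁₄, htot, hb, -Nat.cast_add, -Nat.cast_one]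
    refine Memory.ext' (fun a i => ?_) fun a i => ?_
    · simp
    · simp only [Memory.real_setReal, Memory.real_setNat, hload]
      split_ifs <;> rfl
  · rw [min_eq_left (not_lt.1 hb)] at hload
    simp [Program.tableEntries, Program.apply, Test.Holds, RealExp.eval, NatExp.eval,
      h₁, h₈, h₁₀, h₁₁, h₁₂, h₁₃, h₁₄, htot, hb, hload]
    rfl

theorem reaches_tables (hP : P.Standing) (hB : 0 < P.base M)
    (h₁ : σ.nat 0 1 = M) (h₂ : σ.nat 2 0 = P.base M) (h₃ : σ.nat 2 1 = P.top M + 1)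
    (hq : σ.nat 2 3 = P.base M ^ (S - 1)) {n : ℕ} (hn : σ.nat 2 4 = n) :
    Reaches P .tables σ (300 * (n + 1) ^ 2) fun σ =>
      σ.nat 2 4 = n ∧ Tabulated P S M n σ := by
  refine Reaches.mono (c := 3 + ((5 + (78 * n + 200)) * n + 5)) (Reaches.seq <|
    reaches_setNat (by simp [NatExp.cost]) <| Reaches.mono
    (reaches_while (c := 78 * n + 200)
      (fun σ => ∃ u ≤ n, σ.nat 0 1 = M ∧ σ.nat 2 0 = P.base M ∧ σ.nat 2 1 = P.top M + 1 ∧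
        σ.nat 2 3 = P.base M ^ (S - 1) ∧ σ.nat 2 4 = n ∧ σ.nat 2 8 = u ∧ Tabulated P S M u σ)
      (fun σ => n - σ.nat 2 8) ?_ ?_ ?_) ?_ fun _ h => h) ?_ fun _ h => h
  · rintro σ ⟨u, hu, h₁, h₂, h₃, hq, hn, h₈, hT⟩ hb
    simp only [Test.Holds, NatExp.eval, hn, h₈] at hb
    have hle : u / (P.top M + 1) ≤ u := Nat.div_le_self _ _
    refine Reaches.mono (c := 26 * (u + 1) + (26 * (u / (P.top M + 1) + 1) +
      (26 * (u / (P.top M + 1) + 1) + 100)))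
      (Reaches.seq <| Reaches.mono (reaches_divMod (by decide) (by decide) (by decide) (by decide)
        (by omega) <| Reaches.seq <| Reaches.mono (reaches_divMod (by decide) (by decide)
        (by decide) (by decide) (by simpa [h₂] using hB) <| Reaches.seq <| Reaches.mono
        (reaches_divMod (by decide) (by decide) (by decide) (by decide)
        (by simpa [hq] using pow_pos hB _) <|
        Program.LoopFree.reaches (by simp [Program.LoopFree, Program.tableEntries]) 
        (by simp [Program.maxCost, Program.tableEntries, NatExp.cost, RealExp.cost, Test.cost]) ?_)
        ?_ fun _ h => h) ?_ fun _ h => h) ?_ fun _ h => h) ?_ fun _ h => h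
    · simp only [Memory.nat_setNat]
      norm_num [h₁, h₂, h₃, hq, hn, h₈]
      rw [apply_tableEntries (u := u) (M := M) (S := S) hP (by simpa) (by simpa) (by simp)
        (by simp; rfl) (by simp; rfl) (by simp; rfl) (by simp; rfl)]
      norm_num [h₁, h₂, h₃, hq, hn, h₈]
      refine ⟨⟨u + 1, hb, rfl, ?_⟩, by omega⟩
      constructor
      all_goals
        intro w hw
        rcases Nat.lt_succ_iff_lt_or_eq.1 hw with hw | rfl
        · simp [hw.ne, hT.older, hT.newer, hT.newest, hT.oldest, hT.load, hw]
        · simp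
    · simp [h₃, h₈]
    · simp [h₃, h₈]
    · simp [h₈]
    · omega
  · rintro σ ⟨u, hu, h₁, h₂, h₃, hq, hn, h₈, hT⟩ hb
    simp only [Test.Holds, NatExp.eval, hn, h₈] at hb
    obtain rfl : u = n := by omega
    exact ⟨hn, hT⟩
  · exact ⟨0, Nat.zero_le _, by simp [NatExp.eval, *], by simp [NatExp.eval, *],
      by simp [NatExp.eval, *], by simp [NatExp.eval, *], by simp [NatExp.eval, *],
      by simp [NatExp.eval, *], by constructor <;> simp⟩
  · simp [Test.cost, NatExp.cost, NatExp.eval]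
  · nlinarith

/-! ### The program: dynamic programming and output -/

namespace RealExp

/-- The load of the vertex in the variable `k`. -/
abbrev loadOf (k : ℕ) : RealExp := .get 4 (.var k)

abbrev newestOf (k : ℕ) : RealExp := .get 2 (.var k)

abbrev oldestOf (k : ℕ) : RealExp := .get 3 (.var k)

abbrev value (k : ℕ) : RealExp := .get 5 (.var k)

/-- The load of the departure from the vertex `8` to the vertex `15`. -/
abbrev increment : RealExp := .sub (loadOf 15) (loadOf 8)

abbrev wait : RealExp := .sub (newestOf 15) (.tau (loadOf 8))

/-- The bottleneck of the arc under consideration. -/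
abbrev candidate : RealExp := .get 6 (.lit 0)

end RealExp

namespace Test

abbrev natEq (e f : NatExp) : Test := .and (.not (.natLt e f)) (.not (.natLt f e))

abbrev realLe (e f : RealExp) : Test := .not (.realLt f e)

abbrev unfinished : Test := .realLt (.loadOf 8) .total

/-- The test for an arc from the vertex in the variable `8` to the one in the variable `15`. -/
abbrev arc : Test :=
  .and (.natLt (.var 8) (.var 15)) <| .and .unfinished <|
  .and (.natEq (.get 3 (.var 15)) (.get 4 (.var 8))) <|
  .and (.realLe (.loadOf 8) (.loadOf 15)) <|
  .and (.realLe .increment .capacity) <|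
  .and (.realLe (.newestOf 8) (.newestOf 15)) <|
  .and (.realLe (.add (.tauBar (.loadOf 15)) (.mul .loadingRate .increment)) (.newestOf 15)) <|
  .realLe (.add (.add (.oldestOf 8) .returnTime) (.mul .loadingRate .increment)) (.newestOf 15)

end Test

namespace Program

/-- Computes the bottleneck of the arc from the vertex `8` to the vertex `15`; the values of the
vertices are in the real array `5`. -/
def storeCandidate : Program :=
  .seq (.setReal 6 (.lit 0) (.value 15))
    (.ite (.and (.realLt (.loadOf 8) (.loadOf 15)) (.realLt .candidate .wait))
      (.setReal 6 (.lit 0) .wait) .skip)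

/-- Takes the arc from the vertex `8` to the vertex `15` into account; the successors of the
vertices are in the natural array `5`. -/
def relax : Program :=
  .seq storeCandidate <|
  .seq (.ite (.and .arc (.realLt .candidate (.value 8)))
    (.seq (.setReal 5 (.var 8) .candidate) (.setNat 5 (.var 8) (.var 15))) .skip) <|
  .setVar 15 (.add (.var 15) (.lit 1))

/-- Passes to the preceding vertex and initializes its value. The model has no real literals, but
zero is a difference. -/
def initValue : Program :=
  .seq (.setVar 8 (.sub (.var 8) (.lit 1))) <|
  .seq (.ite .unfinished (.setReal 5 (.var 8) .horizon)
    (.setReal 5 (.var 8) (.sub .period .period))) <|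
  .setVar 15 (.lit 0)

/-- Dynamic programming, from the last vertex to the first one. -/
def solve : Program :=
  .seq (.setVar 8 (.var 4))
    (.while (.natLt (.lit 0) (.var 8))
      (.seq initValue (.while (.natLt (.var 15) (.var 4)) relax)))

/-- Appends the departure to the successor of the vertex `8` to the output. -/
def emit : Program :=
  .seq (.setVar 8 (.get 5 (.var 8))) <|
  .seq (.setNat 1 (.lit 0) (.add (.get 1 (.lit 0)) (.lit 1))) <|
  .seq (.setReal 0 (.get 1 (.lit 0)) (.newestOf 8)) <|
  .setReal 1 (.get 1 (.lit 0)) (.loadOf 8)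

/-- Writes the departures along the optimal path to the output. -/
def output : Program :=
  .seq (.seq (.setVar 8 (.lit 0)) (.setNat 1 (.lit 0) (.lit 0))) (.while .unfinished emit)

end Program

variable {P : Terminal} {S M : ℕ} {σ : Memory}

theorem apply_storeCandidate {u v : ℕ} (hT : Tabulated P S M (P.vertices S M) σ)
    (hu : u < P.vertices S M) (hv : v < P.vertices S M)
    (h₈ : σ.nat 2 8 = u) (h₁₅ : σ.nat 2 15 = v) :
    Program.storeCandidate.apply P σ = σ.setReal 6 0 (P.bottleneck M (σ.real 5) u v) := by
  unfold Terminal.bottleneck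
  simp only [Program.storeCandidate, Program.apply, Test.Holds, RealExp.eval, NatExp.eval,
    Memory.nat_setReal, Memory.real_setReal, h₈, h₁₅, hT.load u hu, hT.load v hv,
    hT.newest v hv]
  norm_num
  split_ifs
  · refine Memory.ext' (fun _ _ => rfl) fun a i => ?_
    simp only [Memory.real_setReal]
    split_ifs <;> rfl
  · rfl

theorem holds_unfinished {u n : ℕ} (hP : P.Standing) (hT : Tabulated P S M n σ) (hu : u < n)
    (h₈ : σ.nat 2 8 = u) :
    Test.unfinished.Holds P σ ↔ P.load M u < P.total := by
  simp only [Test.Holds, RealExp.eval, NatExp.eval, h₈, hT.load u hu, clamp_period hP]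
  rfl

theorem holds_arc {u v : ℕ} (hP : P.Standing) (hT : Tabulated P S M (P.vertices S M) σ)
    (hu : u < P.vertices S M) (hv : v < P.vertices S M)
    (h₈ : σ.nat 2 8 = u) (h₁₅ : σ.nat 2 15 = v) :
    Test.arc.Holds P σ ↔ P.Arc S M u v := by
  have : Test.arc.Holds P σ ↔ _ ∧ Test.unfinished.Holds P σ ∧ _ := Iff.rfl
  rw [this, holds_unfinished hP hT hu h₈]
  simp only [Test.Holds, RealExp.eval, NatExp.eval, h₈, h₁₅, hT.load u hu, hT.load v hv,
    hT.newest u hu, hT.newest v hv, hT.oldest u hu, hT.older v hv, hT.newer u hu, not_lt]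
  constructor
  · rintro ⟨h1, h2, ⟨h3, h3'⟩, h4, h5, h6, h7, h8⟩
    exact ⟨h1, hv, h2, le_antisymm h3' h3, h4, h5, h6, h7, h8⟩
  · rintro ⟨h1, -, h2, h3, h4, h5, h6, h7, h8⟩
    exact ⟨h1, h2, ⟨h3.ge, h3.le⟩, h4, h5, h6, h7, h8⟩

open Classical in
theorem apply_relax {u v : ℕ} (hP : P.Standing) (hT : Tabulated P S M (P.vertices S M) σ)
    (hu : u < P.vertices S M) (hv : v < P.vertices S M)
    (h₈ : σ.nat 2 8 = u) (h₁₅ : σ.nat 2 15 = v) :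
    Program.relax.apply P σ =
      (if P.Arc S M u v ∧ P.bottleneck M (σ.real 5) u v < σ.real 5 u then
        ((σ.setReal 6 0 (P.bottleneck M (σ.real 5) u v)).setReal 5 u
          (P.bottleneck M (σ.real 5) u v)).setNat 5 u v
      else σ.setReal 6 0 (P.bottleneck M (σ.real 5) u v)).setNat 2 15 (v + 1) := by
  simp only [Program.relax, Program.apply, apply_storeCandidate hT hu hv h₈ h₁₅]
  set ρ := σ.setReal 6 0 (P.bottleneck M (σ.real 5) u v) with hρ
  have hb : (Test.and .arc (.realLt .candidate (.value 8))).Holds P ρ ↔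
      P.Arc S M u v ∧ P.bottleneck M (σ.real 5) u v < σ.real 5 u := by
    have hT' : Tabulated P S M (P.vertices S M) ρ :=
      hT.congr (fun _ _ => rfl) (fun _ _ => rfl) fun a i ha _ => by
        simp only [hρ, Memory.real_setReal]
        rw [if_neg]
        rintro ⟨rfl, -⟩
        simp at ha
    rw [← holds_arc hP hT' hu hv h₈ h₁₅]
    simp [Test.Holds, RealExp.eval, NatExp.eval, hρ, h₈]
  simp only [hb]
  split_ifs
  · simp [NatExp.eval, RealExp.eval, hρ, h₈, h₁₅]
  · simp [NatExp.eval, hρ, h₁₅]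

theorem reaches_relax {u : ℕ} (hP : P.Standing) (hT : Tabulated P S M (P.vertices S M) σ)
    (hn : σ.nat 2 4 = P.vertices S M) (hu : u < P.vertices S M) (h₈ : σ.nat 2 8 = u)
    (h₁₅ : σ.nat 2 15 = 0) (hV : P.SolvedAt S M (σ.real 5) (σ.nat 5) u 0) :
    Reaches P (.while (.natLt (.var 15) (.var 4)) .relax) σ (200 * P.vertices S M + 5) fun σ' =>
      Tabulated P S M (P.vertices S M) σ' ∧ σ'.nat 2 4 = P.vertices S M ∧ σ'.nat 2 8 = u ∧
      P.SolvedAt S M (σ'.real 5) (σ'.nat 5) u (P.vertices S M) ∧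
      ∀ v ≠ u, σ'.real 5 v = σ.real 5 v ∧ σ'.nat 5 v = σ.nat 5 v := by
  refine Reaches.mono (reaches_while (c := 195)
    (fun σ' => ∃ v ≤ P.vertices S M, Tabulated P S M (P.vertices S M) σ' ∧
      σ'.nat 2 4 = P.vertices S M ∧ σ'.nat 2 8 = u ∧ σ'.nat 2 15 = v ∧
      P.SolvedAt S M (σ'.real 5) (σ'.nat 5) u v ∧
      ∀ v ≠ u, σ'.real 5 v = σ.real 5 v ∧ σ'.nat 5 v = σ.nat 5 v)
    (fun σ' => P.vertices S M - σ'.nat 2 15) ?_ ?_ ⟨0, Nat.zero_le _, hT, hn, h₈, h₁₅, hV,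
      fun _ _ => ⟨rfl, rfl⟩⟩) ?_ fun _ h => h
  · rintro σ' ⟨v, hvn, hT, hn, h₈, h₁₅, hV, hσ⟩ hb
    simp only [Test.Holds, NatExp.eval, hn, h₁₅] at hb
    refine Program.LoopFree.reaches
      (by simp [Program.LoopFree, Program.relax, Program.storeCandidate])
      (by simp [Program.maxCost, Program.relax, Program.storeCandidate, NatExp.cost, RealExp.cost,
        Test.cost]) ?_
    rw [apply_relax hP hT hu hb h₈ h₁₅]
    split_ifs with hif
    · refine ⟨⟨v + 1, hb, ?_, by simp [hn], by simp [h₈], by simp, ?_, ?_⟩, ?_⟩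
      · refine hT.congr (by simp) (by simp) fun a i ha hi => ?_
        simp only [Memory.real_setNat, Memory.real_setReal]
        rcases ha with rfl | rfl | rfl <;> norm_num
      · have hW : ∀ w, u < w → (((((σ'.setReal 6 0 (P.bottleneck M (σ'.real 5) u v)).setReal 5 u
            (P.bottleneck M (σ'.real 5) u v)).setNat 5 u v).setNat 2 15 (v + 1)).real 5 w) =
            σ'.real 5 w := fun w hw => by simp [hw.ne']
        constructor
        · exact fun h => (h hif.1.unfinished).elim
        · intro _ _
          simp only [Memory.nat_setNat]
          norm_num
          refine ⟨hif.1, le_of_eq (Terminal.bottleneck_congr ?_)⟩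
          simp [hif.1.lt.ne']
        · intro w hw ha
          rw [Terminal.bottleneck_congr (hW w ha.lt)]
          norm_num
          rcases Nat.lt_succ_iff_lt_or_eq.1 hw with hw | rfl
          · exact hif.2.le.trans (hV.le w hw ha)
          · exact le_rfl
      · intro w hw
        simp [hw, hσ w hw]
      · simp [h₁₅]; omega
    · refine ⟨⟨v + 1, hb, ?_, by simp [hn], by simp [h₈], by simp, ?_, ?_⟩, ?_⟩
      · refine hT.congr (by simp) (by simp) fun a i ha hi => ?_
        simp only [Memory.real_setNat, Memory.real_setReal]
        rcases ha with rfl | rfl | rfl <;> norm_num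
      · have hW : ∀ w, ((σ'.setReal 6 0 (P.bottleneck M (σ'.real 5) u v)).setNat 2 15
            (v + 1)).real 5 w = σ'.real 5 w := fun w => by simp
        have := hV.congr (fun w _ => hW w) (next' := σ'.nat 5) rfl
        refine ⟨this.final, ?_, ?_⟩
        · intro h h'
          rw [hW] at h' ⊢
          rw [Terminal.bottleneck_congr (hW _)]
          exact hV.arc h h'
        · intro w hw ha
          rcases Nat.lt_succ_iff_lt_or_eq.1 hw with hw | rfl
          · exact this.le w hw ha
          · rw [Terminal.bottleneck_congr (hW w), hW]
            exact not_lt.1 fun h => hif ⟨ha, h⟩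
      · intro w hw
        simp [hσ w hw]
      · simp [h₁₅]; omega
  · rintro σ' ⟨v, hvn, hT, hn, h₈, h₁₅, hV, hσ⟩ hb
    simp only [Test.Holds, NatExp.eval, hn, h₁₅] at hb
    obtain rfl : v = P.vertices S M := by omega
    exact ⟨hT, hn, h₈, hV, hσ⟩
  · simp only [Test.cost, NatExp.cost, h₁₅]; omega

theorem reaches_solve (hP : P.Standing) (hT : Tabulated P S M (P.vertices S M) σ)
    (hn : σ.nat 2 4 = P.vertices S M) :
    Reaches P .solve σ (400 * (P.vertices S M + 1) ^ 2) fun σ =>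
      Tabulated P S M (P.vertices S M) σ ∧ P.Solved S M (σ.real 5) (σ.nat 5) := by
  refine Reaches.mono (c := 4 + ((4 + (80 + (200 * P.vertices S M + 5))) * P.vertices S M + 4))
    (Reaches.seq <|
    reaches_setNat (by simp [NatExp.cost]) <| Reaches.mono
    (reaches_while (c := 80 + (200 * P.vertices S M + 5))
      (fun σ => ∃ u ≤ P.vertices S M, Tabulated P S M (P.vertices S M) σ ∧
        σ.nat 2 4 = P.vertices S M ∧ σ.nat 2 8 = u ∧ ∀ w < P.vertices S M, u ≤ w →
          P.SolvedAt S M (σ.real 5) (σ.nat 5) w (P.vertices S M))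
      (fun σ => σ.nat 2 8) ?_ ?_ ?_) ?_ fun _ h => h) ?_ fun _ h => h
  · rintro σ ⟨u, hu, hT, hn, h₈, hV⟩ hb
    simp only [Test.Holds, NatExp.eval, h₈] at hb
    obtain ⟨u, rfl⟩ : ∃ u', u = u' + 1 := ⟨u - 1, by omega⟩
    refine Reaches.seq <| Program.LoopFree.reaches
      (by simp [Program.LoopFree, Program.initValue])
      (by simp [Program.maxCost, Program.initValue, NatExp.cost, RealExp.cost,
        Test.cost]) ?_
    obtain ⟨x, hx, hx', heq⟩ : ∃ x : ℝ, (¬ P.load M u < P.total → x = 0) ∧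
        (P.load M u < P.total → x = P.horizon) ∧
        Program.initValue.apply P σ = ((σ.setNat 2 8 u).setReal 5 u x).setNat 2 15 0 := by
      have hh := holds_unfinished 
        (σ := (Program.setVar 8 (.sub (.var 8) (.lit 1))).apply P σ) hP
        (hT.congr (by simp [Program.apply, NatExp.eval]) (by simp [Program.apply, NatExp.eval])
          fun _ _ _ _ => rfl) hu (by simp [Program.apply, NatExp.eval, h₈])
      by_cases h : P.load M u < P.total
      · refine ⟨P.horizon, fun h' => (h' h).elim, fun _ => rfl, ?_⟩
        rw [Program.initValue, Program.apply_seq, Program.apply_seq,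
          Program.apply_ite_of_holds (hh.2 h)]
        simp only [Program.apply, NatExp.eval, eval_horizon hP]
        simp [h₈]
      · refine ⟨0, fun _ => rfl, fun h' => (h h').elim, ?_⟩
        rw [Program.initValue, Program.apply_seq, Program.apply_seq,
          Program.apply_ite_of_not_holds (hh.not.2 h)]
        simp [Program.apply, NatExp.eval, RealExp.eval, h₈]
    rw [heq]
    refine (reaches_relax (u := u) hP ?_ ?_ hu ?_ ?_ ?_).mono le_rfl ?_
    · refine hT.congr (by simp) (by simp) fun a i ha hi => ?_
      simp only [Memory.real_setNat, Memory.real_setReal]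
      rcases ha with rfl | rfl | rfl <;> norm_num
    · simp [hn]
    · simp
    · simp
    · refine ⟨by simpa using hx, fun h h' => ?_, fun _ h => absurd h (Nat.not_lt_zero _)⟩
      simp [hx' h] at h'
    · rintro σ' ⟨hT', hn', h₈', hV', hσ⟩
      refine ⟨⟨u, by omega, hT', hn', h₈', fun w hw huw => ?_⟩, by omega⟩
      rcases huw.eq_or_lt with rfl | huw
      · exact hV'
      · refine (hV w hw huw).congr (fun v hv => ?_) ?_
        · rw [(hσ v (by omega)).1]; simp; omega
        · rw [(hσ w (by omega)).2]; simp
  · rintro σ ⟨u, hu, hT, hn, h₈, hV⟩ hb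
    simp only [Test.Holds, NatExp.eval, h₈] at hb
    exact ⟨hT, fun w hw => hV w hw (by omega)⟩
  · refine ⟨P.vertices S M, le_rfl, hT.congr (by simp) (by simp) fun _ _ _ _ => rfl,
      by simp [NatExp.eval, hn], by simp [NatExp.eval, hn], fun w hw hw' => by omega⟩
  · simp [Test.cost, NatExp.cost, NatExp.eval, hn]
  · nlinarith

/-- The output is the path of the successors of the vertex `0`. -/
structure Traced (P : Terminal) (S M : ℕ) (V : ℕ → ℝ) (next : ℕ → ℕ) (N : ℕ) (σ : Memory) :
    Prop where
  outN : σ.outN = N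
  time : ∀ j, 1 ≤ j → j ≤ N → σ.real 0 j = P.newest M (next^[j] 0)
  load : ∀ j, 1 ≤ j → j ≤ N → σ.real 1 j = P.load M (next^[j] 0)
  lt_vertices : ∀ j ≤ N, next^[j] 0 < P.vertices S M
  value_le : ∀ j ≤ N, V (next^[j] 0) ≤ V 0
  arc : ∀ j < N, P.Arc S M (next^[j] 0) (next^[j + 1] 0)
  bottleneck_le : ∀ j < N, P.bottleneck M V (next^[j] 0) (next^[j + 1] 0) ≤ V 0

theorem reaches_output (hP : P.Standing) (hT : Tabulated P S M (P.vertices S M) σ)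
    (hV : P.Solved S M (σ.real 5) (σ.nat 5)) (h0 : 0 < P.vertices S M)
    (hH : σ.real 5 0 < P.horizon) :
    Reaches P .output σ (100 * (P.vertices S M + 1)) fun σ' =>
      ∃ N, Traced P S M (σ.real 5) (σ.nat 5) N σ' ∧
        ¬ P.load M ((σ.nat 5)^[N] 0) < P.total := by
  set V := σ.real 5 with hVdef
  set next := σ.nat 5 with hnext
  refine Reaches.mono (c := 6 + ((6 + 40) * P.vertices S M + 6))
    (Reaches.seq <| Program.LoopFree.reaches (by simp [Program.LoopFree])
      (by simp [Program.maxCost, NatExp.cost]) <| Reaches.mono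
    (reaches_while (c := 40)
      (fun σ => ∃ N, Tabulated P S M (P.vertices S M) σ ∧ σ.nat 5 = next ∧
        σ.nat 2 8 = next^[N] 0 ∧ Traced P S M V next N σ)
      (fun σ => P.vertices S M - σ.nat 2 8) ?_ ?_ ?_) ?_ fun _ h => h) ?_ fun _ h => h
  · rintro σ ⟨N, hT, hn, h₈, hN⟩ hb
    have hu := hN.lt_vertices N le_rfl
    rw [holds_unfinished hP hT hu h₈] at hb
    obtain ⟨ha, hle⟩ := (hV _ hu).arc hb ((hN.value_le N le_rfl).trans_lt hH)
    rw [← Function.iterate_succ_apply' next N 0] at ha hle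
    have hout : σ.nat 1 0 = N := hN.outN
    have hσ : Program.emit.apply P σ = (((σ.setNat 2 8 (next^[N + 1] 0)).setNat 1 0 (N + 1)).setReal
        0 (N + 1) (P.newest M (next^[N + 1] 0))).setReal 1 (N + 1) (P.load M (next^[N + 1] 0)) := by
      simp [Program.emit, Program.apply, NatExp.eval, RealExp.eval, h₈, hn, hout,
        ← Function.iterate_succ_apply' next N 0, hT.load _ ha.lt_vertices,
        hT.newest _ ha.lt_vertices, -Function.iterate_succ]
    refine Program.LoopFree.reaches (by simp [Program.LoopFree, Program.emit])
      (by simp [Program.maxCost, Program.emit, NatExp.cost, RealExp.cost]) ?_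
    rw [hσ]
    refine ⟨⟨N + 1, ?_, ?_, ?_, ?_⟩, ?_⟩
    · refine hT.congr (by simp) (by simp) fun a i ha hi => ?_
      simp only [Memory.real_setNat, Memory.real_setReal]
      rcases ha with rfl | rfl | rfl <;> norm_num
    · funext i; simp [← hn]
    · simp [-Function.iterate_succ]
    · constructor
      · simp [Memory.outN]
      · intro j h1 h2
        rcases h2.eq_or_lt with rfl | h2
        · simp [-Function.iterate_succ]
        · simp [h2.ne, hN.time j h1 (by omega)]
      · intro j h1 h2
        rcases h2.eq_or_lt with rfl | h2
        · simp [-Function.iterate_succ]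
        · simp [h2.ne, hN.load j h1 (by omega)]
      · intro j hj
        rcases hj.eq_or_lt with rfl | hj
        · exact ha.lt_vertices
        · exact hN.lt_vertices j (by omega)
      · intro j hj
        rcases hj.eq_or_lt with rfl | hj
        · exact Terminal.le_bottleneck.trans (hle.trans (hN.value_le N le_rfl))
        · exact hN.value_le j (by omega)
      · intro j hj
        rcases (Nat.lt_succ_iff.1 hj).eq_or_lt with rfl | hj
        · exact ha
        · exact hN.arc j hj
      · intro j hj
        rcases (Nat.lt_succ_iff.1 hj).eq_or_lt with rfl | hj
        · exact hle.trans (hN.value_le j le_rfl)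
        · exact hN.bottleneck_le j hj
    · have : next^[N] 0 < next^[N + 1] 0 := ha.lt
      have : next^[N + 1] 0 < P.vertices S M := ha.lt_vertices
      simp [h₈, -Function.iterate_succ]; omega
  · rintro σ ⟨N, hT, hn, h₈, hN⟩ hb
    rw [holds_unfinished hP hT (hN.lt_vertices N le_rfl) h₈] at hb
    exact ⟨N, hN, hb⟩
  · refine ⟨0, hT.congr (by simp [Program.apply, NatExp.eval])
      (by simp [Program.apply, NatExp.eval]) fun _ _ _ _ => rfl, ?_,
      by simp [Program.apply, NatExp.eval], ?_⟩
    · funext i; simp [Program.apply, NatExp.eval, hnext]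
    · constructor
      · simp [Program.apply, NatExp.eval, Memory.outN]
      · intro j h1 h2; omega
      · intro j h1 h2; omega
      · intro j hj; obtain rfl : j = 0 := by omega
        exact h0
      · intro j hj; obtain rfl : j = 0 := by omega
        exact le_rfl
      · intro j hj; omega
      · intro j hj; omega
  · simp [Program.apply, Test.cost, NatExp.cost, NatExp.eval, RealExp.cost]
  · omega

/-! ### Growth of the demand and its pseudo-inverses -/

namespace Terminal

variable {P : Terminal}

/-- A lower bound for the right derivative is a lower bound for the growth; `D` need not be
continuous. -/
theorem add_mul_le_of_derivWithin_gt (hmono : MonotoneOn P.D (Set.Icc 0 P.T))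
    (hd : ∀ t ∈ Set.Ico 0 P.T, DifferentiableWithinAt ℝ P.D (Set.Ioi t) t) {c : ℝ}
    (hc : ∀ t ∈ Set.Ico 0 P.T, c < derivWithin P.D (Set.Ioi t) t) {s t : ℝ} (hs : 0 ≤ s)
    (hst : s ≤ t) (ht : t ≤ P.T) : P.D s + c * (t - s) ≤ P.D t := by
  -- The supremum of the times at which the bound holds is itself such a time, because an upward
  -- jump does no harm; the right derivative there leaves no room below `t`.
  set A : Set ℝ := {r | r ∈ Set.Icc s t ∧ P.D s + c * (r - s) ≤ P.D r} with hA
  have hsA : s ∈ A := ⟨⟨le_rfl, hst⟩, by simp⟩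
  have hbdd : BddAbove A := ⟨t, fun r hr => hr.1.2⟩
  set r := sSup A with hr
  have hsr : s ≤ r := le_csSup hbdd hsA
  have hrt : r ≤ t := csSup_le ⟨s, hsA⟩ fun x hx => hx.1.2
  have hrA : P.D s + c * (r - s) ≤ P.D r := by
    obtain ⟨x, -, hx, hxA⟩ := exists_seq_tendsto_sSup ⟨s, hsA⟩ hbdd
    have hlim : Tendsto (fun n => P.D s + c * (x n - s)) atTop (𝓝 (P.D s + c * (r - s))) :=
      ((hx.sub_const s).const_mul c).const_add _
    refine le_of_tendsto' hlim fun n => ?_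
    obtain ⟨⟨h1, h2⟩, h3⟩ := hxA n
    exact h3.trans (hmono ⟨hs.trans h1, h2.trans ht⟩ ⟨hs.trans hsr, hrt.trans ht⟩
      (le_csSup hbdd (hxA n)))
  rcases hrt.eq_or_lt with h | h
  · rwa [h] at hrA
  · have hrI : r ∈ Set.Ico 0 P.T := ⟨hs.trans hsr, h.trans_le ht⟩
    have hslope := (hasDerivWithinAt_iff_tendsto_slope' (by simp)).1 (hd r hrI).hasDerivWithinAt
    have hev := (hslope.eventually_const_lt (hc r hrI)).and (Ioo_mem_nhdsGT h)
    obtain ⟨x, hx, hrx, hxt⟩ := hev.exists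
    rw [slope_def_field, lt_div_iff₀ (sub_pos.2 hrx)] at hx
    have : x ≤ r := le_csSup hbdd ⟨⟨hsr.trans hrx.le, hxt.le⟩, by linarith⟩
    exact absurd hrx this.not_gt

theorem exists_growth (hmono : MonotoneOn P.D (Set.Icc 0 P.T))
    (hd : ∀ t ∈ Set.Ico 0 P.T, DifferentiableWithinAt ℝ P.D (Set.Ioi t) t)
    (hinf : 0 < (⨅ t : Set.Ico 0 P.T, derivWithin P.D (Set.Ioi (t : ℝ)) (t : ℝ))) :
    ∃ c > 0, ∀ s t, 0 ≤ s → s ≤ t → t ≤ P.T → P.D s + c * (t - s) ≤ P.D t := by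
  have hbdd : BddBelow (Set.range fun t : Set.Ico 0 P.T =>
      derivWithin P.D (Set.Ioi (t : ℝ)) (t : ℝ)) := by
    -- the infimum of a family that is not bounded below is the junk value `0`
    by_contra h
    exact hinf.ne' (Real.iInf_of_not_bddBelow h)
  refine ⟨_, half_pos hinf, fun s t hs hst ht =>
    add_mul_le_of_derivWithin_gt hmono hd (fun r hr => ?_) hs hst ht⟩
  exact (half_lt_self hinf).trans_le (ciInf_le hbdd ⟨r, hr⟩)

variable {y y' : ℝ}

theorem tauBar_nonneg (hT : 0 ≤ P.T) : 0 ≤ P.tauBar y := by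
  unfold tauBar; split_ifs
  · exact Real.sInf_nonneg fun t ht => ht.1.1
  · exact hT

theorem tauBar_le_of_mem {t : ℝ} (hT : t ∈ Set.Icc 0 P.T) (hy : y ≤ P.D t)
    (hyT : y ≤ P.D P.T) : P.tauBar y ≤ t := by
  rw [tauBar, if_pos hyT]
  exact csInf_le ⟨0, fun _ h => h.1.1⟩ ⟨hT, hy⟩

theorem tauBar_le_period (hT : 0 ≤ P.T) : P.tauBar y ≤ P.T := by
  by_cases h : y ≤ P.D P.T
  · exact tauBar_le_of_mem ⟨hT, le_rfl⟩ h h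
  · rw [tauBar, if_neg h]

theorem tau_nonneg (hT : 0 ≤ P.T) : 0 ≤ P.tau y := by
  unfold tau; split_ifs
  · exact Real.sInf_nonneg fun t ht => ht.1.1
  · exact hT

theorem tau_le_period (hT : 0 ≤ P.T) : P.tau y ≤ P.T := by
  unfold tau; split_ifs with h
  · exact csInf_le ⟨0, fun _ h => h.1.1⟩ ⟨⟨hT, le_rfl⟩, h⟩
  · exact le_rfl

theorem tau_mono (hT : 0 ≤ P.T) (h : y ≤ y') : P.tau y ≤ P.tau y' := by
  by_cases hy' : y' < P.D P.T
  · rw [tau, tau, if_pos hy', if_pos (h.trans_lt hy')]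
    exact csInf_le_csInf ⟨0, fun _ h => h.1.1⟩ ⟨P.T, ⟨hT, le_rfl⟩, hy'⟩
      fun t ht => ⟨ht.1, h.trans_lt ht.2⟩
  · rw [tau.eq_def P y', if_neg hy']
    exact tau_le_period hT

theorem tau_le_tauBar (hT : 0 ≤ P.T) (h : y < y') (hy' : y' ≤ P.D P.T) :
    P.tau y ≤ P.tauBar y' := by
  rw [tau, tauBar, if_pos hy', if_pos (h.trans_le hy')]
  exact csInf_le_csInf ⟨0, fun _ h => h.1.1⟩ ⟨P.T, ⟨hT, le_rfl⟩, hy'⟩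
    fun t ht => ⟨ht.1, h.trans_le ht.2⟩

/-- If `D` grows at least at the rate `c`, then `τ̄` is Lipschitz with the constant `1 / c`. -/
theorem tauBar_le_add {c : ℝ} (hT : 0 ≤ P.T) (hc : 0 < c)
    (hD : ∀ s t, 0 ≤ s → s ≤ t → t ≤ P.T → P.D s + c * (t - s) ≤ P.D t)
    (h : y ≤ y') (hy' : y' ≤ P.D P.T) : P.tauBar y' ≤ P.tauBar y + c⁻¹ * (y' - y) := by
  rw [← sub_le_iff_le_add, tauBar.eq_def P y, if_pos (h.trans hy')]
  refine le_csInf ⟨P.T, ⟨hT, le_rfl⟩, h.trans hy'⟩ fun s hs => ?_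
  rw [sub_le_iff_le_add]
  have hpos : 0 ≤ c⁻¹ * (y' - y) := mul_nonneg (inv_pos.2 hc).le (sub_nonneg.2 h)
  by_cases hsT : s + c⁻¹ * (y' - y) ≤ P.T
  · refine tauBar_le_of_mem ⟨by linarith [hs.1.1], hsT⟩ ?_ hy'
    have := hD s _ hs.1.1 (le_add_of_nonneg_right hpos) hsT
    rw [add_sub_cancel_left, mul_inv_cancel_left₀ hc.ne'] at this
    linarith [hs.2]
  · exact (tauBar_le_period hT).trans (not_le.1 hsT).le

end Terminal

/-! ### Codes of windows of a sequence -/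

theorem sum_mul_pow_lt {B m : ℕ} {f : ℕ → ℕ} (hf : ∀ s < m, f s < B) :
    ∑ s ∈ Finset.range m, f s * B ^ s < B ^ m := by
  induction m with
  | zero => simp
  | succ m ih =>
    rw [Finset.sum_range_succ, pow_succ]
    have h1 := ih fun s hs => hf s (by omega)
    have h2 : f m + 1 ≤ B := hf m (by omega)
    nlinarith [Nat.mul_le_mul_left (B ^ m) h2]

/-- The number with the `m` digits `k j, k (j - 1), …` in base `B`, the lowest one first. The
truncated subtraction repeats `k 0` before the beginning of the sequence. -/
def window (B : ℕ) (k : ℕ → ℕ) (m j : ℕ) : ℕ := ∑ s ∈ Finset.range m, k (j - s) * B ^ s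

section Window

variable {B m j : ℕ} {k : ℕ → ℕ}

theorem window_lt (hk : ∀ i ≤ j, k i < B) : window B k m j < B ^ m :=
  sum_mul_pow_lt fun s _ => hk _ (Nat.sub_le j s)

theorem window_succ_left : window B k (m + 1) j = k (j - m) * B ^ m + window B k m j := by
  rw [window, Finset.sum_range_succ, add_comm, window]

theorem window_succ_succ : window B k (m + 1) (j + 1) = B * window B k m j + k (j + 1) := by
  rw [window, Finset.sum_range_succ', window, Finset.mul_sum]
  simp only [Nat.add_sub_add_right, pow_zero, mul_one, Nat.sub_zero]
  congr 1
  exact Finset.sum_congr rfl fun s _ => by ring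

theorem window_mod (hk : ∀ i ≤ j, k i < B) (hm : 1 ≤ m) : window B k m j % B = k j := by
  obtain ⟨m, rfl⟩ := Nat.exists_eq_add_of_le' hm
  rw [window, Finset.sum_range_succ']
  simp only [pow_succ, ← mul_assoc, ← Finset.sum_mul]
  simp [Nat.mod_eq_of_lt (hk j le_rfl)]

theorem window_mod_pow (hk : ∀ i ≤ j, k i < B) :
    window B k (m + 1) j % B ^ m = window B k m j := by
  rw [window_succ_left, mul_comm, Nat.mul_add_mod, Nat.mod_eq_of_lt (window_lt hk)]

theorem window_div_pow (hB : 0 < B) (hk : ∀ i ≤ j, k i < B) :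
    window B k (m + 1) j / B ^ m = k (j - m) := by
  rw [window_succ_left, mul_comm, Nat.mul_add_div (pow_pos hB _),
    Nat.div_eq_of_lt (window_lt hk), add_zero]

theorem window_succ_div (hB : 0 < B) (hk : k (j + 1) < B) :
    window B k (m + 1) (j + 1) / B = window B k m j := by
  rw [window_succ_succ, Nat.mul_add_div hB, Nat.div_eq_of_lt hk, add_zero]

/-- The code of a window increases if the sequence does not decrease and the window loses a digit
smaller than the one it gains. -/
theorem window_lt_window_succ (hB : 0 < B) (hmono : ∀ i ≤ j, k i ≤ k (i + 1))
    (hlt : k (j + 1 - m) < k (j + 1)) : window B k m j < window B k m (j + 1) := by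
  have hle : ∀ s, k (j - s) ≤ k (j + 1 - s) := fun s => by
    rcases le_or_gt s j with h | h
    · rw [Nat.succ_sub h]; exact hmono _ (Nat.sub_le _ _)
    · rw [Nat.sub_eq_zero_of_le h.le, Nat.sub_eq_zero_of_le h]
  have hle' : ∀ s ∈ Finset.range m, k (j - s) * B ^ s ≤ k (j + 1 - s) * B ^ s :=
    fun s _ => Nat.mul_le_mul_right _ (hle s)
  refine (Finset.sum_le_sum hle').lt_of_ne fun heq => hlt.ne ?_
  rw [Finset.sum_eq_sum_iff_of_le hle'] at heq
  have key : ∀ s ≤ m, k (j + 1 - s) = k (j + 1) := fun s => by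
    induction s with
    | zero => simp
    | succ s ih =>
      intro hs
      have := Nat.eq_of_mul_eq_mul_right (pow_pos hB s) (heq s (Finset.mem_range.2 hs))
      rw [Nat.add_sub_add_right, this, ih (by omega)]
  exact key m le_rfl

end Window

namespace Terminal

/-! ### Schedules on the grids -/

variable {P : Terminal} {S M : ℕ} {V : ℕ → ℝ} {next : ℕ → ℕ}

theorem total_pos (hP : P.Standing) : 0 < P.total := hP.D_total_pos

theorem dead_pos (hP : P.Standing) (hπ : 0 < P.π) : 0 < P.dead :=
  add_pos_of_pos_of_nonneg hπ (mul_nonneg hP.ν_nonneg hP.C_pos.le)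

theorem horizon_pos (hP : P.Standing) (hπ : 0 < P.π) : 0 < P.horizon := by
  have h1 := mul_nonneg hP.ν_nonneg hP.C_pos.le
  have h2 := div_nonneg (total_pos hP).le hP.C_pos.le
  have h3 := hP.T_pos
  unfold horizon
  positivity

theorem lt_base (hπ : 0 < P.π) (hM : 1 ≤ M) {k : ℕ}
    (hk : P.gridTime M k < P.horizon) : k < P.base M := by
  have hδ : 0 < P.π / M := div_pos hπ (by exact_mod_cast hM)
  refine Nat.lt_ceil.2 ((lt_div_iff₀ hδ).2 ?_)
  unfold gridTime at hk
  linarith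

theorem two_le_base (hP : P.Standing) (hπ : 0 < P.π) (hM : 1 ≤ M) : 2 ≤ P.base M := by
  refine lt_base hπ hM ?_
  have hM' : (1 : ℝ) ≤ M := by exact_mod_cast hM
  have h1 : P.π / M ≤ P.π := div_le_self hπ.le hM'
  have h2 := mul_nonneg hP.ν_nonneg hP.C_pos.le
  have h3 := horizon_pos hP hπ
  simp only [gridTime, dead, Nat.cast_one]
  linarith

theorem gridLoad_le_total {i : ℕ} : P.gridLoad M i ≤ P.total := min_le_right _ _

theorem gridLoad_zero (hP : P.Standing) : P.gridLoad M 0 = 0 := by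
  simp [gridLoad, (total_pos hP).le]

theorem load_zero (hP : P.Standing) : P.load M 0 = 0 := by
  simp [load, gridLoad_zero hP]

theorem gridTime_ceil {a : ℝ} (hP : P.Standing) (hπ : 0 < P.π) (hM : 1 ≤ M) (ha : 0 ≤ a) :
    a ≤ P.gridTime M ⌈(a + P.dead) / (P.π / M)⌉₊ ∧
      P.gridTime M ⌈(a + P.dead) / (P.π / M)⌉₊ < a + P.π / M := by
  have hδ : 0 < P.π / M := div_pos hπ (by exact_mod_cast hM)
  have hnn : 0 ≤ (a + P.dead) / (P.π / M) :=
    div_nonneg (add_nonneg ha (dead_pos hP hπ).le) hδ.le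
  have h1 := (div_le_iff₀ hδ).1 (Nat.le_ceil ((a + P.dead) / (P.π / M)))
  have h2 := mul_lt_mul_of_pos_right (Nat.ceil_lt_add_one hnn) hδ
  rw [add_mul, div_mul_cancel₀ _ hδ.ne', one_mul] at h2
  constructor <;> unfold gridTime <;> linarith

/-- A schedule whose loads lie on the grid and whose departure times leave room for one step of
the time grid bounds the computed value. -/
theorem Solved.le_of_schedule (hP : P.Standing) (hπ : 0 < P.π) (hS : 1 ≤ S) (hM : 1 ≤ M)
    (hV : P.Solved S M V next) {N : ℕ} {a : ℕ → ℝ} {i : ℕ → ℕ} {w : ℝ} (hw : 0 ≤ w)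
    (hi₀ : i 0 = 0) (hi : ∀ j, i j ≤ P.top M) (hN : ¬ P.gridLoad M (i N) < P.total)
    (hmono : ∀ j < N, P.gridLoad M (i j) ≤ P.gridLoad M (i (j + 1)))
    (hcap : ∀ j < N, P.gridLoad M (i (j + 1)) - P.gridLoad M (i j) ≤ P.C)
    (ha : ∀ j, 1 ≤ j → j < N → a j ≤ a (j + 1))
    (hload : ∀ j < N, P.tauBar (P.gridLoad M (i (j + 1))) +
      P.ν * (P.gridLoad M (i (j + 1)) - P.gridLoad M (i j)) ≤ a (j + 1))
    (hret : ∀ j, 1 ≤ j → j + S ≤ N → a j + P.π +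
      P.ν * (P.gridLoad M (i (j + S)) - P.gridLoad M (i (j + S - 1))) + P.π / M ≤ a (j + S))
    (hhor : ∀ j < N, a (j + 1) + P.π / M ≤ P.horizon)
    (hwait : ∀ j < N, P.gridLoad M (i j) < P.gridLoad M (i (j + 1)) →
      a (j + 1) + P.π / M - P.tau (P.gridLoad M (i j)) ≤ w) : V 0 ≤ w := by
  have hδ : 0 < P.π / M := div_pos hπ (by exact_mod_cast hM)
  have hB : 0 < P.base M := (two_le_base hP hπ hM).trans' (by norm_num)
  have hx : ∀ j < N, 0 ≤ P.ν * (P.gridLoad M (i (j + 1)) - P.gridLoad M (i j)) :=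
    fun j hj => mul_nonneg hP.ν_nonneg (sub_nonneg.2 (hmono j hj))
  have ha0 : ∀ j < N, 0 ≤ a (j + 1) := fun j hj =>
    (add_nonneg (tauBar_nonneg hP.T_pos.le) (hx j hj)).trans (hload j hj)
  set k : ℕ → ℕ := fun j => if j = 0 then 0 else ⌈(a j + P.dead) / (P.π / M)⌉₊ with hk
  have hk0 : k 0 = 0 := if_pos rfl
  have hks : ∀ j < N, a (j + 1) ≤ P.gridTime M (k (j + 1)) ∧
      P.gridTime M (k (j + 1)) < a (j + 1) + P.π / M := fun j hj =>
    gridTime_ceil hP hπ hM (ha0 j hj)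
  have hkB : ∀ j ≤ N, k j < P.base M := by
    rintro (_ | j) hj
    · rwa [hk0]
    · exact lt_base hπ hM ((hks j hj).2.trans_le (hhor j hj))
  have hkmono : ∀ j < N, k j ≤ k (j + 1) := by
    rintro (_ | j) hj
    · simp [hk0]
    · simp only [hk, Nat.succ_ne_zero, if_false]
      have := ha (j + 1) (by omega) hj
      gcongr
  obtain ⟨m, rfl⟩ := Nat.exists_eq_add_of_le' hS
  have hreturn : ∀ j < N, P.gridTime M (k (j - m)) + P.π +
      P.ν * (P.gridLoad M (i (j + 1)) - P.gridLoad M (i j)) ≤ P.gridTime M (k (j + 1)) := by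
    intro j hj
    refine le_trans ?_ (hks j hj).1
    rcases le_or_gt j m with hjm | hjm
    · -- the shuttle has not left yet
      rw [Nat.sub_eq_zero_of_le hjm, hk0]
      have := mul_le_mul_of_nonneg_left (hcap j hj) hP.ν_nonneg
      simp only [gridTime, dead, Nat.cast_zero]
      linarith [ha0 j hj]
    · obtain ⟨l, rfl⟩ : ∃ l, j = l + 1 + m := ⟨j - m - 1, by omega⟩
      have h1 := hret (l + 1) (by omega) (by omega)
      have h2 := (hks l (by omega)).2
      rw [Nat.add_sub_cancel]
      simp only [← add_assoc, Nat.add_sub_cancel] at h1 ⊢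
      linarith
  set c : ℕ → ℕ := fun j => window (P.base M) k (m + 1) j with hc
  have hkj : ∀ j ≤ N, ∀ l ≤ j, k l < P.base M := fun j hj l hl => hkB l (hl.trans hj)
  have hclt : ∀ j < N, c j < c (j + 1) := by
    intro j hj
    refine window_lt_window_succ hB (fun l hl => hkmono l (by omega)) ?_
    rw [Nat.add_sub_add_right]
    by_contra hle
    have h1 : (k (j + 1) : ℝ) ≤ k (j - m) := by exact_mod_cast not_lt.1 hle
    have h2 := mul_le_mul_of_nonneg_right h1 hδ.le
    have h3 := hreturn j hj
    have h4 := hx j hj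
    unfold gridTime at h3
    linarith
  set u : ℕ → ℕ := fun j => c j * (P.top M + 1) + i j with hu
  have hcode : ∀ j, P.code M (u j) = c j := fun j => by
    simp only [code, hu]
    rw [mul_comm, Nat.mul_add_div (Nat.succ_pos _),
      Nat.div_eq_of_lt (Nat.lt_succ_of_le (hi j)), add_zero]
  have huload : ∀ j, P.load M (u j) = P.gridLoad M (i j) := fun j => by
    simp only [load, hu]
    rw [mul_comm, Nat.mul_add_mod, Nat.mod_eq_of_lt (Nat.lt_succ_of_le (hi j))]
  have hunew : ∀ j ≤ N, P.newest M (u j) = P.gridTime M (k j) := fun j hj => by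
    rw [newest, hcode, hc, window_mod (hkj j hj) (by omega)]
  have huV : ∀ j ≤ N, u j < P.vertices (m + 1) M := fun j hj => by
    have h1 : c j + 1 ≤ P.base M ^ (m + 1) := window_lt (hkj j hj)
    have h2 := Nat.mul_le_mul_right (P.top M + 1) h1
    have h3 := hi j
    simp only [vertices, hu]
    rw [add_mul] at h2
    omega
  have harc : ∀ j < N, P.load M (u j) < P.total → P.Arc (m + 1) M (u j) (u (j + 1)) := by
    intro j hj hlt
    have hold : P.oldest (m + 1) M (u j) = P.gridTime M (k (j - m)) := by
      rw [oldest, hcode, Nat.add_sub_cancel, hc, window_div_pow hB (hkj j hj.le)]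
    refine ⟨?_, huV _ hj, hlt, ?_, ?_, ?_, ?_, ?_, ?_⟩
    · have h2 := Nat.mul_le_mul_right (P.top M + 1) (Nat.succ_le_of_lt (hclt j hj))
      have h3 := hi j
      simp only [hu]
      rw [Nat.succ_mul] at h2
      omega
    · rw [older, newer, hcode, hcode, Nat.add_sub_cancel, hc]
      simp only
      rw [window_mod_pow (hkj j hj.le), window_succ_div hB (hkB _ hj)]
    · rw [huload, huload]; exact hmono j hj
    · rw [huload, huload]; exact hcap j hj
    · rw [hunew j hj.le, hunew _ hj]
      have : (k j : ℝ) ≤ k (j + 1) := by exact_mod_cast hkmono j hj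
      unfold gridTime
      gcongr
    · rw [huload, huload, hunew _ hj]
      exact (hload j hj).trans (hks j hj).1
    · rw [huload, huload, hunew _ hj, hold]
      exact hreturn j hj
  have key : ∀ n ≤ N, V (u (N - n)) ≤ w := by
    intro n
    induction n with
    | zero =>
      intro _
      rw [Nat.sub_zero, (hV _ (huV N le_rfl)).final (by rwa [huload])]
      exact hw
    | succ n ih =>
      intro hn
      obtain ⟨j, hj⟩ : ∃ j, j = N - (n + 1) := ⟨_, rfl⟩
      have hj' : N - n = j + 1 := by omega
      have hjN : j < N := by omega
      rw [hj'] at ih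
      rw [← hj]
      by_cases hlt : P.load M (u j) < P.total
      · refine ((hV _ (huV j hjN.le)).le _ (huV _ hjN) (harc j hjN hlt)).trans ?_
        unfold bottleneck
        split_ifs with hif
        · rw [huload, huload] at hif
          rw [hunew _ hjN, huload]
          linarith [hwait j hjN hif.1, (hks j hjN).2]
        · exact ih (by omega)
      · rw [(hV _ (huV j hjN.le)).final hlt]
        exact hw
  have hu0 : u 0 = 0 := by
    simp [hu, hc, window, hi₀, hk0]
  simpa [hu0] using key N le_rfl

end Terminal

/-! ### Full shuttles one after the other -/

namespace Terminal

variable {P : Terminal} {S M : ℕ} {V : ℕ → ℝ} {next : ℕ → ℕ}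

theorem gridLoad_of_top_le (hP : P.Standing) (hM : 1 ≤ M) {i : ℕ} (hi : P.top M ≤ i) :
    P.gridLoad M i = P.total := by
  have hη : 0 < P.C / M := div_pos hP.C_pos (by exact_mod_cast hM)
  exact min_eq_right ((div_le_iff₀ hη).1 (Nat.ceil_le.1 hi))

theorem gridLoad_mono (hP : P.Standing) {i j : ℕ} (h : i ≤ j) :
    P.gridLoad M i ≤ P.gridLoad M j := by
  have := hP.C_pos
  unfold gridLoad
  gcongr

theorem gridLoad_sub_le {i j : ℕ} (hP : P.Standing) (hM : 1 ≤ M) (h : j ≤ i + M) :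
    P.gridLoad M j - P.gridLoad M i ≤ P.C := by
  have hM' : (0 : ℝ) < M := by exact_mod_cast hM
  have hη : 0 < P.C / M := div_pos hP.C_pos hM'
  have h1 : (j : ℝ) ≤ i + M := by exact_mod_cast h
  have h2 := mul_le_mul_of_nonneg_right h1 hη.le
  rw [add_mul, mul_div_cancel₀ _ hM'.ne'] at h2
  rw [sub_le_iff_le_add, gridLoad, gridLoad]
  rcases min_cases ((i : ℝ) * (P.C / M)) P.total with h | h
  · rw [h.1]; exact (min_le_left _ _).trans (by linarith)
  · rw [h.1]; exact (min_le_right _ _).trans (by linarith [hP.C_pos])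

/-- A bound for the waiting times when one full shuttle leaves after the other from time `T` on. -/
def crude (P : Terminal) : ℝ := P.horizon - P.T - P.π

theorem crude_pos (hP : P.Standing) (hπ : 0 < P.π) : 0 < P.crude := by
  have h1 := mul_nonneg hP.ν_nonneg hP.C_pos.le
  have h2 := div_nonneg (total_pos hP).le hP.C_pos.le
  have h3 := hP.T_pos
  have h4 : P.crude = P.T + (P.total / P.C + 1) * (P.π + P.π + P.ν * P.C) + P.π := by
    unfold crude horizon; ring
  rw [h4]
  positivity

/-- The schedule with one full shuttle after the other is a path of the network, however coarse the
grids are. -/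
theorem Solved.le_crude (hP : P.Standing) (hπ : 0 < P.π) (hS : 1 ≤ S) (hM : 1 ≤ M)
    (hV : P.Solved S M V next) : V 0 ≤ P.crude := by
  have hM' : (1 : ℝ) ≤ M := by exact_mod_cast hM
  have hδ : 0 < P.π / M := div_pos hπ (by linarith)
  have hδπ : P.π / M ≤ P.π := div_le_self hπ.le hM'
  have hνC := mul_nonneg hP.ν_nonneg hP.C_pos.le
  have hYC := div_nonneg (total_pos hP).le hP.C_pos.le
  have hcrude : P.crude = P.T + (P.total / P.C + 1) * (P.π + P.π + P.ν * P.C) + P.π := by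
    unfold crude horizon; ring
  set i : ℕ → ℕ := fun j => min (j * M) (P.top M) with hi
  set a : ℕ → ℝ := fun j => P.T + j * (P.π + P.ν * P.C + P.π / M) with ha
  have hstep : ∀ j, a j + (P.π + P.ν * P.C + P.π / M) = a (j + 1) := fun j => by
    simp only [ha]; push_cast; ring
  have hamono : Monotone a := monotone_nat_of_le_succ fun j => by
    rw [← hstep]; linarith
  have hcap : ∀ j, P.gridLoad M (i (j + 1)) - P.gridLoad M (i j) ≤ P.C := fun j =>
    gridLoad_sub_le hP hM (by
      simp only [hi, Nat.succ_mul]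
      rcases le_total (j * M) (P.top M) with h | h
      · rw [min_eq_left h]; exact min_le_left _ _
      · rw [min_eq_right h]; exact (min_le_right _ _).trans (Nat.le_add_right _ _))
  have hhor : ∀ j < ⌈P.total / P.C⌉₊, a (j + 1) + P.π / M ≤ P.crude := by
    intro j hj
    have h1 : ((j + 1 : ℕ) : ℝ) ≤ P.total / P.C + 1 :=
      (Nat.cast_le.2 hj).trans (Nat.ceil_lt_add_one hYC).le
    have h2 : ((j + 1 : ℕ) : ℝ) * (P.π + P.ν * P.C + P.π / M) ≤
        (P.total / P.C + 1) * (P.π + P.π + P.ν * P.C) :=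
      mul_le_mul h1 (by linarith) (by linarith) (by linarith)
    simp only [ha, hcrude]
    linarith
  refine hV.le_of_schedule hP hπ hS hM (N := ⌈P.total / P.C⌉₊) (a := a) (i := i)
    (crude_pos hP hπ).le (by simp [hi]) (fun j => min_le_right _ _) ?_ ?_ (fun j _ => hcap j)
    (fun j _ _ => hamono (Nat.le_succ j)) ?_ ?_ ?_ ?_
  · rw [not_lt]
    simp only [hi]
    rcases le_total (⌈P.total / P.C⌉₊ * M) (P.top M) with h | h
    · rw [min_eq_left h, gridLoad]
      refine le_min ?_ le_rfl
      have := (div_le_iff₀ hP.C_pos).1 (Nat.le_ceil (P.total / P.C))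
      push_cast
      rwa [mul_assoc, mul_div_cancel₀ _ (by linarith)]
    · rw [min_eq_right h, gridLoad_of_top_le hP hM le_rfl]
  · exact fun j _ => gridLoad_mono hP
      (min_le_min_right _ (Nat.mul_le_mul_right _ (Nat.le_succ j)))
  · intro j _
    have h1 := mul_le_mul_of_nonneg_left (hcap j) hP.ν_nonneg
    have h2 : P.tauBar (P.gridLoad M (i (j + 1))) ≤ P.T := tauBar_le_period hP.T_pos.le
    have h3 : a 1 ≤ a (j + 1) := hamono (by omega)
    have h4 : a 1 = P.T + (P.π + P.ν * P.C + P.π / M) := by simp [ha]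
    linarith
  · intro j _ _
    obtain ⟨S, rfl⟩ := Nat.exists_eq_add_of_le' hS
    have h1 := mul_le_mul_of_nonneg_left (hcap (j + S)) hP.ν_nonneg
    have h2 : a j ≤ a (j + S) := hamono (by omega)
    have h3 := hstep (j + S)
    rw [← add_assoc, Nat.add_sub_cancel]
    linarith
  · exact fun j hj => (hhor j hj).trans (by unfold crude; linarith [hP.T_pos])
  · intro j hj _
    have : 0 ≤ P.tau (P.gridLoad M (i j)) := tau_nonneg hP.T_pos.le
    linarith [hhor j hj]

theorem Solved.lt_horizon (hP : P.Standing) (hπ : 0 < P.π) (hS : 1 ≤ S) (hM : 1 ≤ M)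
    (hV : P.Solved S M V next) : V 0 < P.horizon :=
  (hV.le_crude hP hπ hS hM).trans_lt (by unfold crude; linarith [hP.T_pos])

/-! ### Schedules of bounded waiting time -/

section Feasible

variable {d y : ℕ → ℝ} {w : ℝ}

theorem Feasible.monotone (h : P.Feasible S d y) : Monotone y :=
  monotone_nat_of_le_succ fun j => h.load_mono (j + 1) (by omega)

theorem Feasible.le_total (h : P.Feasible S d y) (j : ℕ) : y j ≤ P.total :=
  h.monotone.ge_of_tendsto h.all_leave j

theorem Feasible.depart_mono (h : P.Feasible S d y) {i j : ℕ} (hi : 1 ≤ i) (hij : i ≤ j) :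
    d i ≤ d j := by
  induction j, hij using Nat.le_induction with
  | base => exact le_rfl
  | succ j hij ih => exact ih.trans (h.no_overtaking (j + 1) (by omega))

theorem wait_le_of_gmax_le (hw : P.gmax d y ≤ (w : EReal)) {j : ℕ} (h : y j < y (j + 1)) :
    d (j + 1) - P.tau (y j) ≤ w := by
  have := iSup₂_le_iff.1 hw (j + 1) ⟨by omega, h⟩
  exact EReal.coe_le_coe_iff.1 this

/-- If the waiting time is bounded, then all users have left after finitely many departures: a
nonempty departure takes place before `T + w`, but the shuttles return arbitrarily late. -/
theorem Feasible.exists_last (hP : P.Standing) (hπ : 0 < P.π) (h : P.Feasible S d y)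
    (hw : P.gmax d y ≤ (w : EReal)) : ∃ N, y N < y (N + 1) ∧ y (N + 1) = P.total := by
  have hex : ∃ N, y N = P.total := by
    by_contra! hne
    have hbound : ∀ j, d (j + 1) ≤ w + P.T := by
      intro j
      obtain ⟨l, hjl, hl⟩ : ∃ l ≥ j, y l < y (l + 1) := by
        by_contra! hall
        have hconst : ∀ l ≥ j, y l = y j := fun l hl => by
          induction l, hl using Nat.le_induction with
          | base => rfl
          | succ l hl ih => exact le_antisymm ((hall l hl).trans ih.le) (h.monotone (by omega))
        exact hne j (tendsto_nhds_unique (tendsto_const_nhds.congr'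
          (eventually_atTop.2 ⟨j, fun l hl => (hconst l hl).symm⟩)) h.all_leave)
      have h1 := wait_le_of_gmax_le hw hl
      have h2 : P.tau (y l) ≤ P.T := tau_le_period hP.T_pos.le
      have h3 := h.depart_mono (i := j + 1) (j := l + 1) (by omega) (by omega)
      linarith
    have hlap : ∀ n : ℕ, n * P.π ≤ d (n * S + 1) := by
      intro n
      induction n with
      | zero => simpa using (h.nonneg 1 le_rfl).1
      | succ n ih =>
        have h1 := h.return_trip (n * S + 1) (by omega)
        have h2 := h.monotone (Nat.sub_le (n * S + 1 + S) 1)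
        have h3 := mul_nonneg hP.ν_nonneg (sub_nonneg.2 h2)
        rw [show (n + 1) * S + 1 = n * S + 1 + S by ring]
        push_cast
        linarith
    obtain ⟨n, hn⟩ := exists_nat_gt ((w + P.T) / P.π)
    rw [div_lt_iff₀ hπ] at hn
    linarith [hlap n, hbound (n * S)]
  classical
  obtain ⟨N, hN⟩ : ∃ N, Nat.find hex = N + 1 := Nat.exists_eq_succ_of_ne_zero fun h0 => by
    have := Nat.find_spec hex
    rw [h0, h.zero] at this
    exact (total_pos hP).ne this
  have h1 : y (N + 1) = P.total := hN ▸ Nat.find_spec hex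
  have h2 : y N ≠ P.total := Nat.find_min hex (by omega)
  exact ⟨N, h1 ▸ lt_of_le_of_ne (h.le_total N) h2, h1⟩

theorem Feasible.gmax_nonneg (hP : P.Standing) (hπ : 0 < P.π) (h : P.Feasible S d y)
    (hw : P.gmax d y ≤ (w : EReal)) : 0 ≤ w := by
  obtain ⟨N, h1, -⟩ := h.exists_last hP hπ hw
  have h2 := wait_le_of_gmax_le hw h1
  have h3 := h.loading (N + 1) (by omega)
  have h4 := mul_nonneg hP.ν_nonneg (sub_nonneg.2 h1.le)
  have h5 := tau_le_tauBar hP.T_pos.le h1 (h.le_total (N + 1))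
  rw [Nat.add_sub_cancel] at h3
  linarith

/-- The rounding error, for a demand that grows at least at the rate `c`, is `error c / M`. -/
def error (P : Terminal) (c : ℝ) : ℝ :=
  (P.π + P.ν * P.C) / P.π * (P.crude + P.T) + (c⁻¹ + P.ν) * P.C + P.π

theorem error_pos (hP : P.Standing) (hπ : 0 < P.π) {c : ℝ} (hc : 0 < c) : 0 < P.error c := by
  have h1 := mul_nonneg hP.ν_nonneg hP.C_pos.le
  have h2 := crude_pos hP hπ
  have h3 := hP.T_pos
  have h4 := hP.ν_nonneg
  have h5 := hP.C_pos
  unfold error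
  positivity

/-- Rounding up the loads of a feasible schedule makes every lap longer by a multiple of `1 / M`.
As a lap takes at least the time `π`, it is enough to slow the schedule down by a factor
`1 + O(1 / M)`, so that the errors of the laps do not add up. -/
theorem Solved.le_of_feasible (hP : P.Standing) (hπ : 0 < P.π) (hS : 1 ≤ S) (hM : 1 ≤ M)
    (hV : P.Solved S M V next) {c : ℝ} (hc : 0 < c)
    (hD : ∀ s t, 0 ≤ s → s ≤ t → t ≤ P.T → P.D s + c * (t - s) ≤ P.D t)
    (h : P.Feasible S d y) (hw : P.gmax d y ≤ (w : EReal)) (hwc : w ≤ P.crude)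
    (he : P.error c / M ≤ P.π) : V 0 ≤ w + P.error c / M := by
  have hM' : (1 : ℝ) ≤ M := by exact_mod_cast hM
  have hM0 : (0 : ℝ) < M := by linarith
  have hν := hP.ν_nonneg
  have hw0 := h.gmax_nonneg hP hπ hw
  obtain ⟨N, hN, hNtot⟩ := h.exists_last hP hπ hw
  set η := P.C / M with hη
  set δ := P.π / M with hδ
  have hη0 : 0 < η := div_pos hP.C_pos hM0
  have hδ0 : 0 < δ := div_pos hπ hM0
  have hνη : 0 ≤ P.ν * η := mul_nonneg hν hη0.le
  have hcη : 0 ≤ c⁻¹ * η := mul_nonneg (inv_pos.2 hc).le hη0.le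
  have hd : ∀ j < N + 1, d (j + 1) ≤ w + P.T := fun j hj => by
    have h1 := wait_le_of_gmax_le hw hN
    have h2 : P.tau (y N) ≤ P.T := tau_le_period hP.T_pos.le
    linarith [h.depart_mono (i := j + 1) (j := N + 1) (by omega) (by omega)]
  set q := (δ + P.ν * η) / P.π with hq
  have hq0 : 0 ≤ q := div_nonneg (by linarith) hπ.le
  have hqπ : q * P.π = δ + P.ν * η := div_mul_cancel₀ _ hπ.ne'
  set a : ℕ → ℝ := fun j => d j + q * d j + (c⁻¹ + P.ν) * η with ha
  set i : ℕ → ℕ := fun j => ⌈y j / η⌉₊ with hi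
  have hy0 : ∀ j, 0 ≤ y j := fun j => h.zero ▸ h.monotone (Nat.zero_le j)
  have hgy : ∀ j, y j ≤ P.gridLoad M (i j) := fun j =>
    le_min ((div_le_iff₀ hη0).1 (Nat.le_ceil _)) (h.le_total j)
  have hgy' : ∀ j, P.gridLoad M (i j) ≤ y j + η := fun j => by
    have := mul_lt_mul_of_pos_right (Nat.ceil_lt_add_one (div_nonneg (hy0 j) hη0.le)) hη0
    rw [add_mul, div_mul_cancel₀ _ hη0.ne', one_mul] at this
    exact (min_le_left _ _).trans this.le
  have hinc : ∀ j, P.ν * (P.gridLoad M (i (j + 1)) - P.gridLoad M (i j)) ≤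
      P.ν * (y (j + 1) - y j) + P.ν * η := fun j => by
    rw [← mul_add]
    exact mul_le_mul_of_nonneg_left (by linarith [hgy j, hgy' (j + 1)]) hν
  have hx : ∀ j, 0 ≤ P.ν * (y (j + 1) - y j) := fun j =>
    mul_nonneg hν (sub_nonneg.2 (h.monotone (Nat.le_succ j)))
  have had : ∀ j < N + 1, a (j + 1) + δ ≤ d (j + 1) + P.error c / M := by
    intro j hj
    have h1 : q * d (j + 1) ≤ q * (P.crude + P.T) :=
      mul_le_mul_of_nonneg_left (by linarith [hd j hj]) hq0
    have h2 : P.error c / M = q * (P.crude + P.T) + (c⁻¹ + P.ν) * η + δ := by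
      simp only [error, hq, hδ, hη]
      field_simp
    simp only [ha]
    linarith
  have hd0 : ∀ j, 0 ≤ d (j + 1) := fun j => (h.nonneg (j + 1) (by omega)).1
  refine hV.le_of_schedule hP hπ hS hM (N := N + 1) (a := a) (i := i)
    (add_nonneg hw0 (div_nonneg (error_pos hP hπ hc).le hM0.le)) (by simp [hi, h.zero])
    (fun j => Nat.ceil_mono (div_le_div_of_nonneg_right (h.le_total j) hη0.le)) ?_ ?_ ?_ ?_ ?_ ?_
    ?_ ?_
  · rw [not_lt, ← hNtot]; exact hgy _
  · exact fun j _ => gridLoad_mono hP (Nat.ceil_mono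
      (div_le_div_of_nonneg_right (h.monotone (Nat.le_succ j)) hη0.le))
  · refine fun j _ => gridLoad_sub_le hP hM (Nat.ceil_le.2 ?_)
    have h1 := h.capacity (j + 1) (by omega)
    have h2 : y j / η ≤ i j := Nat.le_ceil _
    have h3 : (M : ℝ) * η = P.C := mul_div_cancel₀ _ hM0.ne'
    rw [div_le_iff₀ hη0] at h2 ⊢
    push_cast
    rw [Nat.add_sub_cancel] at h1
    linarith
  · intro j hj _
    have := h.no_overtaking (j + 1) (by omega)
    rw [Nat.add_sub_cancel] at this
    have := mul_le_mul_of_nonneg_left this hq0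
    simp only [ha]
    linarith
  · intro j hj
    have h1 := h.loading (j + 1) (by omega)
    have h2 := tauBar_le_add hP.T_pos.le hc hD (hgy (j + 1)) gridLoad_le_total
    have h3 : c⁻¹ * (P.gridLoad M (i (j + 1)) - y (j + 1)) ≤ c⁻¹ * η :=
      mul_le_mul_of_nonneg_left (by linarith [hgy' (j + 1)]) (inv_pos.2 hc).le
    have h4 := mul_nonneg hq0 (hd0 j)
    rw [Nat.add_sub_cancel] at h1
    simp only [ha, add_mul]
    linarith [hinc j]
  · intro j hj hjS
    have h1 := h.return_trip j hj
    have h2 := hinc (j + S - 1)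
    have h3 := hx (j + S - 1)
    rw [show j + S - 1 + 1 = j + S by omega] at h2 h3
    have h4 := mul_le_mul_of_nonneg_left h1 hq0
    rw [mul_add, mul_add, hqπ] at h4
    have h5 := mul_nonneg hq0 h3
    simp only [ha]
    linarith
  · intro j hj
    have := had j hj
    unfold crude at hwc
    linarith [hd j hj]
  · intro j hj hlt
    have hlt' : y j < y (j + 1) := by
      refine lt_of_le_of_ne (h.monotone (Nat.le_succ j)) fun heq => ?_
      simp [hi, ← heq] at hlt
    have h1 := wait_le_of_gmax_le hw hlt'
    have h2 := tau_mono hP.T_pos.le (hgy j)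
    linarith [had j hj]

end Feasible

end Terminal

/-! ### The output is a schedule -/

section Output

variable {P : Terminal} {S M N : ℕ} {V : ℕ → ℝ} {next : ℕ → ℕ} {σ : Memory}

theorem Traced.outY_eq (hP : P.Standing) (h : Traced P S M V next N σ) {j : ℕ} (hj : j ≤ N) :
    σ.outY P j = P.load M (next^[j] 0) := by
  unfold Memory.outY
  rw [h.outN, if_pos hj]
  split_ifs with h0
  · rw [h0, Function.iterate_zero, id, Terminal.load_zero hP]
  · exact h.load j (by omega) hj

theorem Traced.outD_eq (h : Traced P S M V next N σ) {j : ℕ} (hj : 1 ≤ j) (hjN : j ≤ N) :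
    σ.outD P j = P.newest M (next^[j] 0) := by
  unfold Memory.outD
  rw [h.outN, if_pos hjN, h.time j hj hjN]

/-- The `s`-th digit of a vertex is the time of the `s`-th last departure. -/
theorem Traced.digit (h : Traced P S M V next N σ) {s j : ℕ} (hs : s ≤ S - 1) (hj : j ≤ N) :
    P.code M (next^[j] 0) / P.base M ^ s % P.base M =
      P.code M (next^[j - s] 0) % P.base M := by
  induction s generalizing j with
  | zero => simp
  | succ s ih =>
    rcases j with _ | j
    · simp [Terminal.code]
    · have hshift := (h.arc j (by omega)).shift
      unfold Terminal.older Terminal.newer at hshift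
      rw [pow_succ', ← Nat.div_div_eq_div_mul, hshift, Nat.add_sub_add_right,
        ← ih (by omega) (by omega)]
      obtain ⟨l, hl⟩ : ∃ l, S - 1 = s + (l + 1) := ⟨S - 1 - s - 1, by omega⟩
      rw [hl, pow_add, Nat.mod_mul_right_div_self, Nat.mod_mod_of_dvd _ (dvd_pow_self _ (by omega))]

theorem Traced.oldest_eq (hS : 1 ≤ S) (h : Traced P S M V next N σ) {j : ℕ} (hj : j ≤ N) :
    P.oldest S M (next^[j] 0) = P.newest M (next^[j - (S - 1)] 0) := by
  have hlt : P.code M (next^[j] 0) / P.base M ^ (S - 1) < P.base M := by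
    have h1 : P.code M (next^[j] 0) < P.base M ^ S :=
      Nat.div_lt_of_lt_mul ((h.lt_vertices j hj).trans_eq (mul_comm _ _))
    rw [← Nat.sub_add_cancel hS, pow_succ] at h1
    exact Nat.div_lt_of_lt_mul h1
  rw [Terminal.oldest, Terminal.newest, ← h.digit le_rfl hj, Nat.mod_eq_of_lt hlt]

theorem Traced.load_eq_total (h : ¬ P.load M (next^[N] 0) < P.total) :
    P.load M (next^[N] 0) = P.total :=
  le_antisymm Terminal.gridLoad_le_total (not_lt.1 h)

theorem Traced.one_le (hP : P.Standing) (hN : ¬ P.load M (next^[N] 0) < P.total) : 1 ≤ N := by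
  rcases Nat.eq_zero_or_pos N with rfl | h
  · rw [Function.iterate_zero, id, Terminal.load_zero hP] at hN
    exact absurd (Terminal.total_pos hP) hN
  · exact h

theorem Traced.outY_of_le (hP : P.Standing) (h : Traced P S M V next N σ)
    (hN : ¬ P.load M (next^[N] 0) < P.total) {j : ℕ} (hj : N ≤ j) : σ.outY P j = P.total := by
  rcases hj.eq_or_lt with rfl | hj
  · rw [h.outY_eq hP le_rfl, Traced.load_eq_total hN]
  · unfold Memory.outY
    rw [h.outN, if_neg (by omega), if_neg (by omega)]
    rfl

theorem Traced.outD_of_le (h : Traced P S M V next N σ) {j : ℕ} (hj : N ≤ j) :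
    σ.outD P j = σ.outD P N + ((j : ℝ) - N) * P.π := by
  rcases hj.eq_or_lt with rfl | hj
  · simp
  · unfold Memory.outD
    rw [h.outN, if_neg (by omega), if_pos le_rfl]

theorem Traced.feasible (hP : P.Standing) (hπ : 0 < P.π) (hS : 1 ≤ S)
    (h : Traced P S M V next N σ) (hN : ¬ P.load M (next^[N] 0) < P.total) :
    P.Feasible S (σ.outD P) (σ.outY P) := by
  have hN1 := Traced.one_le hP hN
  have hν := hP.ν_nonneg
  have hmono : Monotone (σ.outY P) := monotone_nat_of_le_succ fun j => by
    rcases lt_or_ge j N with hj | hj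
    · rw [h.outY_eq hP hj, h.outY_eq hP hj.le]
      exact (h.arc j hj).load_mono
    · rw [h.outY_of_le hP hN hj, h.outY_of_le hP hN (by omega)]
  have hzero : σ.outY P 0 = 0 := if_pos rfl
  have hdmono : ∀ j, 1 ≤ j → σ.outD P j ≤ σ.outD P (j + 1) := fun j hj1 => by
    rcases lt_or_ge j N with hj | hj
    · rw [h.outD_eq (by omega) hj, h.outD_eq hj1 hj.le]
      exact (h.arc j hj).no_overtaking
    · rw [h.outD_of_le hj, h.outD_of_le (j := j + 1) (by omega)]
      push_cast
      linarith
  have hdle : ∀ i j, 1 ≤ i → i ≤ j → σ.outD P i ≤ σ.outD P j := fun i j hi hij => by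
    induction j, hij using Nat.le_induction with
    | base => exact le_rfl
    | succ j hij ih => exact ih.trans (hdmono j (by omega))
  have hload : ∀ j, P.tauBar (σ.outY P (j + 1)) + P.ν * (σ.outY P (j + 1) - σ.outY P j) ≤
      σ.outD P (j + 1) := fun j => by
    rcases lt_or_ge j N with hj | hj
    · rw [h.outY_eq hP hj, h.outY_eq hP hj.le, h.outD_eq (by omega) hj]
      exact (h.arc j hj).loading
    · obtain ⟨n, rfl⟩ := Nat.exists_eq_add_of_le' hN1
      have ha := h.arc n (by omega)
      have h1 := ha.loading
      have h2 := mul_nonneg hν (sub_nonneg.2 ha.load_mono)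
      rw [← h.outD_eq (by omega) le_rfl, Traced.load_eq_total hN] at h1
      rw [Traced.load_eq_total hN] at h2
      rw [h.outY_of_le hP hN hj, h.outY_of_le hP hN (by omega), sub_self, mul_zero]
      linarith [hdle (n + 1) (j + 1) (by omega) (by omega)]
  refine ⟨hzero, fun j hj => ?_, fun j hj => ?_, fun j _ => hmono (Nat.sub_le j 1), fun j hj => ?_,
    ?_, fun j hj => ?_, fun j hj => ?_⟩
  · obtain ⟨j, rfl⟩ := Nat.exists_eq_add_of_le' hj
    refine ⟨?_, hzero ▸ hmono (Nat.zero_le _)⟩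
    have h1 := hload j
    have h2 := mul_nonneg hν (sub_nonneg.2 (hmono (Nat.le_succ j)))
    have h3 : 0 ≤ P.tauBar (σ.outY P (j + 1)) := Terminal.tauBar_nonneg hP.T_pos.le
    linarith
  · obtain ⟨j, rfl⟩ := Nat.exists_eq_add_of_le' hj
    rw [Nat.add_sub_cancel]
    rcases lt_or_ge j N with hj | hj
    · rw [h.outY_eq hP hj, h.outY_eq hP hj.le]
      exact (h.arc j hj).capacity
    · rw [h.outY_of_le hP hN hj, h.outY_of_le hP hN (by omega), sub_self]
      exact hP.C_pos.le
  · obtain ⟨j, rfl⟩ := Nat.exists_eq_add_of_le' hj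
    exact hdmono _ (by omega)
  · exact tendsto_const_nhds.congr' (eventually_atTop.2
      ⟨N, fun j hj => (h.outY_of_le hP hN hj).symm⟩)
  · obtain ⟨j, rfl⟩ := Nat.exists_eq_add_of_le' hj
    exact hload j
  · obtain ⟨m, rfl⟩ := Nat.exists_eq_add_of_le' hS
    rw [← add_assoc, Nat.add_sub_cancel]
    rcases lt_or_ge (j + m) N with hjN | hjN
    · have ha := (h.arc (j + m) hjN).return_trip
      rw [h.oldest_eq (by omega) hjN.le, Nat.add_sub_cancel, Nat.add_sub_cancel] at ha
      rwa [h.outY_eq hP hjN, h.outY_eq hP hjN.le, h.outD_eq (by omega) hjN,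
        h.outD_eq hj (by omega)]
    · rw [h.outY_of_le hP hN hjN, h.outY_of_le hP hN (by omega), sub_self, mul_zero, add_zero,
        h.outD_of_le (j := j + m + 1) (by omega)]
      have h1 := h.outD_of_le hjN
      have h2 := hdle j (j + m) hj (by omega)
      push_cast at h1 ⊢
      linarith

theorem Traced.gmax_le (hP : P.Standing)
    (h : Traced P S M V next N σ) (hN : ¬ P.load M (next^[N] 0) < P.total) :
    P.gmax (σ.outD P) (σ.outY P) ≤ (V 0 : EReal) := by
  refine iSup₂_le fun j hj => EReal.coe_le_coe_iff.2 ?_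
  obtain ⟨hj1, hlt⟩ := hj
  obtain ⟨j, rfl⟩ := Nat.exists_eq_add_of_le' hj1
  rw [Nat.add_sub_cancel] at hlt ⊢
  rcases lt_or_ge j N with hj | hj
  · rw [h.outY_eq hP hj, h.outY_eq hP hj.le] at hlt
    rw [h.outY_eq hP hj.le, h.outD_eq (by omega) hj]
    exact (Terminal.wait_le_bottleneck hlt).trans (h.bottleneck_le j hj)
  · rw [h.outY_of_le hP hN hj, h.outY_of_le hP hN (by omega)] at hlt
    exact absurd hlt (lt_irrefl _)

end Output

/-! ### Running time and gap -/

/-- The algorithm: grids, vertices, tables, dynamic programming, output. -/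
def Program.schedule : Program :=
  .seq .gridSizes <| .seq .powers <| .seq (.mul 4 7 2 1) <| .seq .tables <| .seq .solve .output

variable {P : Terminal} {S M : ℕ}

theorem reaches_schedule (hP : P.Standing) (hπ : 0 < P.π) (hS : 1 ≤ S) (hM : 1 ≤ M) :
    Reaches P .schedule (.input S M) (5200 * P.vertices S M ^ 2) fun σ =>
      ∃ V next N, P.Solved S M V next ∧ Traced P S M V next N σ ∧
        ¬ P.load M (next^[N] 0) < P.total := by
  have hB : 2 ≤ P.base M := Terminal.two_le_base hP hπ hM
  have hn : P.vertices S M = P.base M ^ S * (P.top M + 1) := rfl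
  have hSB : S + 1 ≤ P.base M ^ S := Nat.lt_two_pow_self.trans_le (Nat.pow_le_pow_left hB S)
  have hBB : P.base M ≤ P.base M ^ S := Nat.le_self_pow (by omega) _
  have hn1 : P.base M ^ S ≤ P.vertices S M := Nat.le_mul_of_pos_right _ (Nat.succ_pos _)
  have hn2 : P.top M + 1 ≤ P.vertices S M := Nat.le_mul_of_pos_left _ (by omega)
  set n := P.vertices S M
  refine Reaches.mono (c := 100 * (P.base M + P.top M + 2) + (60 * (P.base M + 2) * (S + 1) +
    (24 * (P.top M + 1 + 1) + (300 * (n + 1) ^ 2 + (400 * (n + 1) ^ 2 + 100 * (n + 1))))))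
    (Reaches.seq <| (reaches_gridSizes hP hπ hM).mono le_rfl ?_) ?_ fun _ h => h
  · rintro σ ⟨h00, h01, h20, h21⟩
    refine Reaches.seq <| (reaches_powers hS h00 h01 h20 h21).mono le_rfl ?_
    rintro σ ⟨h01, h20, h21, h22, h23⟩
    refine Reaches.seq <| (reaches_mul (by decide) (by decide) (by decide) (by decide)
      (by decide) ?_).mono (by rw [h21]) fun _ h => h
    refine Reaches.seq <| (reaches_tables (S := S) (M := M) (n := n) hP (by omega)
      ?_ ?_ ?_ ?_ ?_).mono le_rfl ?_
    · simp [h01]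
    · simp [h20]
    · simp [h21]
    · simp [h23]
    · simp [h22, h21, hn]
    rintro σ ⟨hσn, hT⟩
    refine Reaches.seq <| (reaches_solve hP hT hσn).mono le_rfl ?_
    rintro σ ⟨hT, hV⟩
    exact (reaches_output hP hT hV (by omega) (hV.lt_horizon hP hπ hS hM)).mono le_rfl
      fun σ' ⟨N, h, hN⟩ => ⟨_, _, N, hV, h, hN⟩
  · have h1 : (P.base M + 2) * (S + 1) ≤ 2 * n * n := Nat.mul_le_mul (by omega) (by omega)
    nlinarith

/-- The number of vertices is at most `(b M) ^ (S + 1)` for a constant `b`. -/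
theorem exists_vertices_le (hP : P.Standing) (hπ : 0 < P.π) :
    ∃ b : ℝ, 1 ≤ b ∧ ∀ S M : ℕ, 1 ≤ M → (P.vertices S M : ℝ) ≤ (b * M) ^ (S + 1) := by
  have h1 : 0 ≤ (P.horizon + P.dead) / P.π :=
    div_nonneg (add_pos (Terminal.horizon_pos hP hπ) (Terminal.dead_pos hP hπ)).le hπ.le
  have h2 : 0 ≤ P.total / P.C := div_nonneg (Terminal.total_pos hP).le hP.C_pos.le
  refine ⟨(P.horizon + P.dead) / P.π + P.total / P.C + 2, by linarith, fun S M hM => ?_⟩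
  have hM' : (1 : ℝ) ≤ M := by exact_mod_cast hM
  have hM0 : (0 : ℝ) ≤ M := by linarith
  have e1 : (P.horizon + P.dead) / (P.π / M) = (P.horizon + P.dead) / P.π * M := by
    rw [div_div_eq_mul_div, mul_div_right_comm]
  have e2 : P.total / (P.C / M) = P.total / P.C * M := by
    rw [div_div_eq_mul_div, mul_div_right_comm]
  have hB := (Nat.ceil_lt_add_one (e1 ▸ mul_nonneg h1 hM0)).le
  have hI := (Nat.ceil_lt_add_one (e2 ▸ mul_nonneg h2 hM0)).le
  have h3 := mul_nonneg h1 hM0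
  have h4 := mul_nonneg h2 hM0
  rw [Terminal.vertices, pow_succ]
  push_cast
  refine mul_le_mul (pow_le_pow_left₀ (Nat.cast_nonneg _) ?_ S) ?_ (by positivity) (by positivity)
  · rw [Terminal.base]
    linarith
  · rw [Terminal.top]
    linarith

end Shuttle

end

/-- One program, which is given the constants of the model and the numbers `S` and `M`, computes
for all of them a feasible schedule, as a finite list of departures after which all users have
left, within the stated time and with the stated gap. -/
theorem theorem3 :
    ∃ prog : Shuttle.Program, ∀ P : Shuttle.Terminal, P.Standing → 0 < P.π →
      (∀ t ∈ Set.Ico 0 P.T, DifferentiableWithinAt ℝ P.D (Set.Ioi t) t) →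
      0 < (⨅ t : Set.Ico 0 P.T, derivWithin P.D (Set.Ioi (t : ℝ)) (t : ℝ)) →
      ∃ K β : ℝ, 0 < K ∧ 0 < β ∧ ∀ S M : ℕ, 1 ≤ S → 1 ≤ M →
        ∃ (σ : Shuttle.Memory) (t : ℕ),
          Shuttle.Exec P prog (Shuttle.Memory.input S M) σ t ∧
          (t : ℝ) ≤ K * (β ^ (3 * S) * (M : ℝ) ^ (3 * S + 2)) ∧
          1 ≤ σ.outN ∧ σ.outY P σ.outN = P.D P.T ∧
          P.Feasible S (σ.outD P) (σ.outY P) ∧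
          P.gmax (σ.outD P) (σ.outY P) ≤
            P.opt S + ((K * ((S : ℝ) ^ 2 / (M : ℝ)) : ℝ) : EReal) := by
  refine ⟨Shuttle.Program.schedule, fun P hP hπ hd hinf => ?_⟩
  obtain ⟨c, hc, hD⟩ := Shuttle.Terminal.exists_growth hP.D_mono hd hinf
  obtain ⟨b, hb1, hb⟩ := Shuttle.exists_vertices_le hP hπ
  have he := Shuttle.Terminal.error_pos hP hπ hc
  have hcr := Shuttle.Terminal.crude_pos hP hπ
  set e := P.error c with hedef
  have hquot : 0 < P.crude * e / P.π := by positivity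
  -- The three summands serve for the running time, for fine grids and for coarse grids.
  refine ⟨5200 * b ^ 2 + e + P.crude * e / P.π, b, by positivity, by linarith,
    fun S M hS hM => ?_⟩
  have hM' : (1 : ℝ) ≤ M := by exact_mod_cast hM
  have hS' : (1 : ℝ) ≤ S := by exact_mod_cast hS
  have hM0 : (0 : ℝ) < M := by linarith
  obtain ⟨σ, t, hexec, ht, V, next, N, hV, hN, hfin⟩ :=
    Shuttle.reaches_schedule hP hπ hS hM
  have hoN : σ.outN = N := hN.outN
  refine ⟨σ, t, hexec, ?_, hoN ▸ Shuttle.Traced.one_le hP hfin, ?_, hN.feasible hP hπ hS hfin, ?_⟩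
  · have h1 : (t : ℝ) ≤ 5200 * (P.vertices S M : ℝ) ^ 2 := by exact_mod_cast ht
    have h2 : (P.vertices S M : ℝ) ^ 2 ≤ ((b * M) ^ (S + 1)) ^ 2 :=
      pow_le_pow_left₀ (Nat.cast_nonneg _) (hb S M hM) 2
    have h3 : ((b * M) ^ (S + 1)) ^ 2 = b ^ 2 * (b ^ (2 * S) * (M : ℝ) ^ (2 * S + 2)) := by ring
    have h4 : b ^ (2 * S) * (M : ℝ) ^ (2 * S + 2) ≤ b ^ (3 * S) * (M : ℝ) ^ (3 * S + 2) := by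
      gcongr <;> first | assumption | omega
    have h5 : 0 ≤ b ^ (3 * S) * (M : ℝ) ^ (3 * S + 2) := by positivity
    calc (t : ℝ) ≤ 5200 * (b ^ 2 * (b ^ (3 * S) * (M : ℝ) ^ (3 * S + 2))) :=
          h1.trans (mul_le_mul_of_nonneg_left (h2.trans (h3.trans_le
            (mul_le_mul_of_nonneg_left h4 (by positivity)))) (by norm_num))
      _ ≤ _ := by
          rw [← mul_assoc]
          exact mul_le_mul_of_nonneg_right (by linarith) h5
  · rw [hoN]; exact hN.outY_of_le hP hfin le_rfl
  · refine (hN.gmax_le hP hfin).trans ?_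
    set r := (5200 * b ^ 2 + e + P.crude * e / P.π) * ((S : ℝ) ^ 2 / (M : ℝ)) with hr
    have hSM : 1 / (M : ℝ) ≤ (S : ℝ) ^ 2 / M := by
      have : (1 : ℝ) ≤ (S : ℝ) ^ 2 := one_le_pow₀ hS'
      gcongr
    have hr1 : e / M ≤ r := by
      rw [div_eq_mul_one_div]
      refine mul_le_mul ?_ hSM (by positivity) (by positivity)
      have : 0 ≤ 5200 * b ^ 2 := by positivity
      linarith
    have hr2 : P.crude * e / P.π / M ≤ r := by
      rw [div_eq_mul_one_div]
      refine mul_le_mul ?_ hSM (by positivity) (by positivity)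
      have : 0 ≤ 5200 * b ^ 2 := by positivity
      linarith
    have key : ∀ d y : ℕ → ℝ, P.Feasible S d y → ∀ w : ℝ, P.gmax d y ≤ (w : EReal) →
        V 0 ≤ w + r := by
      intro d y hf w hw
      have hcrude := hV.le_crude hP hπ hS hM
      have hr0 : 0 ≤ r := (by positivity : 0 ≤ e / M).trans hr1
      rcases le_or_gt P.crude w with hwc | hwc
      · linarith
      rcases le_or_gt (e / M) P.π with hfine | hcoarse
      · exact (hV.le_of_feasible hP hπ hS hM hc hD hf hw hwc.le hfine).trans (by linarith)
      · -- on a coarse grid the error term exceeds every waiting time under consideration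
        have hw0 := hf.gmax_nonneg hP hπ hw
        have : P.crude ≤ P.crude * e / P.π / M := by
          rw [mul_div_assoc, mul_div_assoc, div_right_comm]
          exact le_mul_of_one_le_right hcr.le ((one_le_div hπ).2 hcoarse.le)
        linarith
    refine EReal.le_of_forall_lt_iff_le.1 fun z hz => ?_
    have hopt : P.opt S < ((z - r : ℝ) : EReal) := by
      rw [EReal.coe_sub]
      exact EReal.lt_sub_iff_add_lt (Or.inl (EReal.coe_ne_bot _))
        (Or.inl (EReal.coe_ne_top _)) |>.2 hz
    obtain ⟨⟨d, y⟩, hs⟩ := iInf_lt_iff.1 hopt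
    obtain ⟨hf, hlt⟩ := iInf_lt_iff.1 hs
    have := key d y hf (z - r) hlt.le
    exact EReal.coe_le_coe_iff.2 (by linarith)
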